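/- **Conventions.** Manifolds are smooth, connected, without boundary; tensor fields are smooth; round brackets around indices denote symmetrization, $\pounds$ is the Lie derivative. *Null hypersurface data* $\{\mathcal N,\gamma,\boldsymbol\ell,\ell^{(2)},\mathbf Y\}$ consist of an $\mathfrak n$-dimensional manifold $\mathcal N$, a symmetric $(0,2)$-tensor $\gamma$ of signature $(0,+,\dots,+)$, a covector $\boldsymbol\ell$, a function $\ell^{(2)}$ and a symmetric $(0,2)$-tensor $\mathbf Y$ such that at every $p\in\mathcal N$ the symmetric bilinear form $$\mathcal A\big((W,a),(Z,b)\big)=\gamma(W,Z)+a\,\boldsymbol\ell(Z)+b\,\boldsymbol\ell(W)+ab\,\ell^{(2)}$$ on $T_p\mathcal N\oplus\mathbb R$ is non-degenerate. Let $n$ be the unique vector field with $\gamma(n,\cdot)=0$, $\boldsymbol\ell(n)=1$ (it is smooth), and put $\mathbf F=\frac12 d\boldsymbol\ell$, $\boldsymbol s=\mathbf F(n,\cdot)$, $\mathbf U=\frac12\pounds_n\gamma$, $\boldsymbol r=\mathbf Y(n,\cdot)$. Let $\overset{\circ}{\nabla}$ be the unique torsion-free connection on $\mathcal N$ with $$\overset{\circ}{\nabla}_a\gamma_{bc}=-\ell_b\mathrm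 U_{ac}-\ell_c\mathrm U_{ab},\qquad \overset{\circ}{\nabla}_a\ell_b=\mathrm F_{ab}-\ell^{(2)}\mathrm U_{ab}.$$ Such data are an *abstract Killing horizon of order one* with symmetry generator $\bar\eta$ if $\bar\eta$ is a vector field on $\mathcal N$ with $\gamma(\bar\eta,\cdot)=0$, the zero set of $\bar\eta$ has empty interior, $\pounds_{\bar\eta}\gamma=0$, and the function $\alpha$ with $\bar\eta=\alpha n$ satisfies $$0=\overset{\circ}{\nabla}_a\overset{\circ}{\nabla}_b\alpha+2(\overset{\circ}{\nabla}_{(a}\alpha)(s_{b)}-r_{b)})+2\alpha\overset{\circ}{\nabla}_{(a}s_{b)}+n(\alpha)\mathrm Y_{ab}-\alpha\pounds_n\mathrm Y_{ab}.$$ The data are *$\{\phi,\zeta\}$-embedded* in a spacetime $(\mathcal M,g)$ (a manifold of dimension $\mathfrak n+1$ with a metric $g$ of signature $(-,+,\dots,+)$) if $\phi:\mathcal N\to\mathcal M$ is a smooth embedding and $\zeta$ is a smooth vector field along $\phi(\mathcal N)$, everywhere transverse to $\phi(\mathcal N)$, with $$\phi^\star g=\gamma,\quad \phi^\star(g(\zeta,\cdot))=\boldsymbol\ell,\quad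 \phi^\star(g(\zeta,\zeta))=\ell^{(2)},\quad \tfrac12\phi^\star(\pounds_\zeta g)=\mathbf Y,$$ where $\zeta$ is extended arbitrarily off $\phi(\mathcal N)$ in the last equation (its left-hand side does not depend on the extension). **Proposition.** Let $\{\mathcal N,\gamma,\boldsymbol\ell,\ell^{(2)},\mathbf Y\}$ be an abstract Killing horizon of order one with symmetry generator $\bar\eta$ which is $\{\phi,\zeta\}$-embedded in a spacetime $(\mathcal M,g)$ with Levi-Civita connection $\nabla$, and let $\eta$ be any smooth extension of $\phi_\star\bar\eta$ to a neighbourhood of $\phi(\mathcal N)$. Let $\mathcal K=\pounds_\eta g$ and $\Sigma=\pounds_\eta\nabla$, that is $\Sigma(X,W)=\pounds_\eta(\nabla_XW)-\nabla_X(\pounds_\eta W)-\nabla_{\pounds_\eta X}W$; let $$\mathfrak p=\phi^\star(\mathcal K(\zeta,\zeta)),\quad \mathfrak w=\phi^\star(\mathcal K(\zeta,\phi_\star n)),\quad \boldsymbol{\mathfrak q}=\phi^\star(\mathcal K(\zeta,\cdot)),\quad \boldsymbol{\mathfrak I}=\tfrac12\phi^\star(\pounds_\zeta\mathcal K),$$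 with any smooth extension of $\zeta$ off $\phi(\mathcal N)$ in the last definition, and let $\mathfrak B_{ab}=\overset{\circ}{\nabla}_{(a}\mathfrak q_{b)}+\mathfrak w\,\mathrm Y_{ab}+\mathfrak p\,\mathrm U_{ab}-\mathfrak I_{ab}$. Then $$\Sigma(\phi_\star Z_1,\phi_\star Z_2)=0\quad\text{for all vectors } Z_1,Z_2 \text{ tangent to } \mathcal N \text{ at the same point},\qquad\text{and}\qquad \mathfrak B_{ab}=0.$$ If in addition $\boldsymbol{\mathfrak q}=0$, then $\phi^\star(\pounds_\zeta\mathcal K)=0$ (for every smooth extension of $\zeta$ off $\phi(\mathcal N)$). -/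

import Mathlib

open Bundle VectorField
open scoped Manifold ContDiff Topology

/-! All manifolds are modelled on a finite-dimensional real vector space `E` by means of
`𝓘(ℝ, E)`: they are smooth and without boundary. -/

set_option linter.unusedSectionVars false
set_option linter.unusedSimpArgs false
set_option linter.style.longLine false

namespace NullHyp

/-! ## Vector fields, covectors and covariant 2-tensors on a manifold -/

section Calculus

/-- Vector fields (no regularity built in). -/
abbrev VField (E : Type*) [NormedAddCommGroup E] [NormedSpace ℝ E]
    (M : Type*) [TopologicalSpace M] [ChartedSpace E M] :=
  Π x : M, TangentSpace 𝓘(ℝ, E) x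

/-- Covector fields (no regularity built in). -/
abbrev Covector (E : Type*) [NormedAddCommGroup E] [NormedSpace ℝ E]
    (M : Type*) [TopologicalSpace M] [ChartedSpace E M] :=
  Π x : M, TangentSpace 𝓘(ℝ, E) x →L[ℝ] ℝ

/-- `(0,2)`-tensor fields (no regularity built in). -/
abbrev Tensor2 (E : Type*) [NormedAddCommGroup E] [NormedSpace ℝ E]
    (M : Type*) [TopologicalSpace M] [ChartedSpace E M] :=
  Π x : M, TangentSpace 𝓘(ℝ, E) x →L[ℝ] TangentSpace 𝓘(ℝ, E) x →L[ℝ] ℝ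

/-- A bilinear form `B` has signature `(ε, +, …, +)`: in some basis it is `diag(ε, 1, …, 1)`. -/
def HasSignature {V : Type*} [AddCommGroup V] [Module ℝ V] [TopologicalSpace V] (ε : ℝ)
    (B : V →L[ℝ] V →L[ℝ] ℝ) : Prop :=
  ∃ (m : ℕ) (b : Module.Basis (Fin (m + 1)) ℝ V),
    ∀ i j, B (b i) (b j) = if i = j then (if i = 0 then ε else 1) else 0

variable {E : Type*} [NormedAddCommGroup E] [NormedSpace ℝ E]
  {M : Type*} [TopologicalSpace M] [ChartedSpace E M]

/-- The derivative `X(f)` of a function `f` along a vector field `X`. -/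
noncomputable def dirDeriv (X : VField E M) (f : M → ℝ) : M → ℝ :=
  fun x ↦ mvfderiv 𝓘(ℝ, E) f x (X x)

/-- The differential `df` of a function. -/
noncomputable def differential (f : M → ℝ) : Covector E M :=
  fun x ↦ mvfderiv 𝓘(ℝ, E) f x

/-- The Lie bracket `[X, Y]`. -/
noncomputable abbrev lieBr (X Y : VField E M) : VField E M := mlieBracket 𝓘(ℝ, E) X Y

variable [IsManifold 𝓘(ℝ, E) ∞ M]

/-- Differentiability of a vector field at a point. -/
def VField.DiffAt (X : VField E M) (x : M) : Prop :=
  MDifferentiableAt 𝓘(ℝ, E) (𝓘(ℝ, E).prod 𝓘(ℝ, E))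
    (fun y ↦ (⟨y, X y⟩ : TangentBundle 𝓘(ℝ, E) M)) x

/-- Smoothness of a vector field on a set. -/
def VField.SmoothOn (X : VField E M) (s : Set M) : Prop :=
  ContMDiffOn 𝓘(ℝ, E) (𝓘(ℝ, E).prod 𝓘(ℝ, E)) ∞
    (fun y ↦ (⟨y, X y⟩ : TangentBundle 𝓘(ℝ, E) M)) s

/-- Differentiability of a covector field at a point. -/
def Covector.DiffAt (σ : Covector E M) (x : M) : Prop :=
  MDifferentiableAt 𝓘(ℝ, E) (𝓘(ℝ, E).prod 𝓘(ℝ, E →L[ℝ] ℝ))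
    (fun y ↦ TotalSpace.mk' (E →L[ℝ] ℝ) y (σ y)) x

/-- Smoothness of a covector field. -/
def Covector.Smooth (σ : Covector E M) : Prop :=
  ContMDiff 𝓘(ℝ, E) (𝓘(ℝ, E).prod 𝓘(ℝ, E →L[ℝ] ℝ)) ∞
    (fun y ↦ TotalSpace.mk' (E →L[ℝ] ℝ) y (σ y))

/-- Differentiability of a `(0,2)`-tensor field at a point. -/
def Tensor2.DiffAt (T : Tensor2 E M) (x : M) : Prop :=
  MDifferentiableAt 𝓘(ℝ, E) (𝓘(ℝ, E).prod 𝓘(ℝ, E →L[ℝ] E →L[ℝ] ℝ))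
    (fun y ↦ TotalSpace.mk' (E →L[ℝ] E →L[ℝ] ℝ) y (T y)) x

/-- Smoothness of a `(0,2)`-tensor field. -/
def Tensor2.Smooth (T : Tensor2 E M) : Prop :=
  ContMDiff 𝓘(ℝ, E) (𝓘(ℝ, E).prod 𝓘(ℝ, E →L[ℝ] E →L[ℝ] ℝ)) ∞
    (fun y ↦ TotalSpace.mk' (E →L[ℝ] E →L[ℝ] ℝ) y (T y))

theorem Covector.Smooth.diffAt {σ : Covector E M} (h : σ.Smooth) (x : M) : σ.DiffAt x :=
  (h x).mdifferentiableAt (by simp)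

theorem Tensor2.Smooth.diffAt {T : Tensor2 E M} (h : T.Smooth) (x : M) : T.DiffAt x :=
  (h x).mdifferentiableAt (by simp)

theorem Tensor2.DiffAt.apply {T : Tensor2 E M} {x : M} (hT : T.DiffAt x) {V W : VField E M} (hV : V.DiffAt x) (hW : W.DiffAt x) :
   MDifferentiableAt 𝓘(ℝ, E) 𝓘(ℝ, ℝ) (fun y ↦ T y (V y) (W y)) x := by
  have := MDifferentiableAt.clm_bundle_apply₂ (F₃ := ℝ) (E₃ := Bundle.Trivial M ℝ) (b := fun y => y) (ψ := T) (v := V) (w := W) hT hV hW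
  rw [mdifferentiableAt_totalSpace] at this
  exact this.2
theorem Covector.DiffAt.apply {T : Covector E M} {x : M} (hT : T.DiffAt x) {V : VField E M} (hV : V.DiffAt x) :
   MDifferentiableAt 𝓘(ℝ, E) 𝓘(ℝ, ℝ) (fun y ↦ T y (V y)) x := by
  have := MDifferentiableAt.clm_bundle_apply (F₂ := ℝ) (E₂ := Bundle.Trivial M ℝ) (b := fun y => y) (ϕ := T) (v := V)  hT hV
  rw [mdifferentiableAt_totalSpace] at this
  exact this.2

theorem VField.DiffAt.add {X Y : VField E M} {x : M} (hX : X.DiffAt x) (hY : Y.DiffAt x) :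
    VField.DiffAt (X + Y) x :=
  mdifferentiableAt_add_section hX hY

theorem VField.DiffAt.smul {f : M → ℝ} {Y : VField E M} {x : M}
    (hf : MDifferentiableAt 𝓘(ℝ, E) 𝓘(ℝ, ℝ) f x) (hY : Y.DiffAt x) :
    VField.DiffAt (f • Y) x :=
  MDifferentiableAt.smul_section hf hY

variable [FiniteDimensional ℝ E]

theorem lieBr_add_left {X Y Z : VField E M} {x : M} (hX : X.DiffAt x) (hY : Y.DiffAt x) : lieBr (X + Y) Z x = lieBr X Z x + lieBr Y Z x :=
  mlieBracket_add_left hX hY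
theorem lieBr_add_right {X Y Z : VField E M} {x : M} (hX : X.DiffAt x) (hY : Y.DiffAt x) : lieBr Z (X + Y) x = lieBr Z X x + lieBr Z Y x :=
  mlieBracket_add_right hX hY
theorem lieBr_smul_left {f : M → ℝ} {Y Z : VField E M} {x : M} (hX : MDifferentiableAt 𝓘(ℝ, E) 𝓘(ℝ, ℝ) f x) (hY : Y.DiffAt x) : 
   lieBr (f • Y) Z x = - dirDeriv Z f x • Y x + f x • lieBr Y Z x :=
  mlieBracket_smul_left hX hY
theorem lieBr_smul_right {f : M → ℝ} {Y Z : VField E M} {x : M} (hX : MDifferentiableAt 𝓘(ℝ, E) 𝓘(ℝ, ℝ) f x) (hY : Y.DiffAt x) : 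
   lieBr Z (f • Y) x = dirDeriv Z f x • Y x + f x • lieBr Z Y x :=
  mlieBracket_smul_right hX hY

theorem dirDeriv_mul {f g : M → ℝ} {Z : VField E M} {x : M} (hf : MDifferentiableAt 𝓘(ℝ, E) 𝓘(ℝ, ℝ) f x) (hg : MDifferentiableAt 𝓘(ℝ, E) 𝓘(ℝ, ℝ) g x) :
   dirDeriv Z (fun y => f y * g y) x = f x * dirDeriv Z g x + g x * dirDeriv Z f x := by
  simp [dirDeriv, mvfderiv_fun_mul hf hg]
theorem dirDeriv_add {f g : M → ℝ} {Z : VField E M} {x : M} (hf : MDifferentiableAt 𝓘(ℝ, E) 𝓘(ℝ, ℝ) f x) (hg : MDifferentiableAt 𝓘(ℝ, E) 𝓘(ℝ, ℝ) g x) :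
   dirDeriv Z (fun y => f y + g y) x = dirDeriv Z f x + dirDeriv Z g x := by
  simp [dirDeriv, mvfderiv_fun_add hf hg]
theorem dirDeriv_add_left {f : M → ℝ} {Y Z : VField E M} {x : M} :
   dirDeriv (Y + Z) f x = dirDeriv Y f x + dirDeriv Z f x := by
  simp [dirDeriv]
theorem dirDeriv_smul_left {f h : M → ℝ} {Z : VField E M} {x : M} :
   dirDeriv (h • Z) f x = h x * dirDeriv Z f x := by
  simp [dirDeriv]

theorem lieBr_swap (X Y : VField E M) (x : M) : lieBr X Y x = - lieBr Y X x := mlieBracket_swap_apply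

theorem exists_field {x : M} (v : TangentSpace 𝓘(ℝ, E) x) : ∃ V : VField E M, V.DiffAt x ∧ V x = v :=
  ⟨FiberBundle.extend E v, FiberBundle.mdifferentiableAt_extend .., by simp⟩

open Classical in
/-- The value at `x` of the `(0,2)`-tensor field `T` prescribed by `T(V, W) = Φ V W` on vector
fields `V`, `W` that are differentiable at `x`; this makes sense when `Φ` is tensorial at `x` in
both arguments (and the value is `0` by convention if `Φ` is not). -/
noncomputable def tensorOf (Φ : VField E M → VField E M → ℝ) (x : M) :
    TangentSpace 𝓘(ℝ, E) x →L[ℝ] TangentSpace 𝓘(ℝ, E) x →L[ℝ] ℝ :=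
  if h : (∀ W : VField E M, W.DiffAt x → TensorialAt 𝓘(ℝ, E) E (Φ · W) x) ∧
      (∀ V : VField E M, V.DiffAt x → TensorialAt 𝓘(ℝ, E) E (Φ V) x) then
    TensorialAt.mkHom₂ Φ x h.1 h.2
  else 0

theorem tensorOf_apply {Φ : VField E M → VField E M → ℝ} {x : M}
    (h1 : ∀ W : VField E M, W.DiffAt x → TensorialAt 𝓘(ℝ, E) E (Φ · W) x) 
      (h2 : ∀ V : VField E M, V.DiffAt x → TensorialAt 𝓘(ℝ, E) E (Φ V) x)
      {V W : VField E M} (hV : V.DiffAt x) (hW : W.DiffAt x) :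
      tensorOf Φ x (V x) (W x) = Φ V W := by
  rw [tensorOf, dif_pos ⟨h1, h2⟩]
  exact TensorialAt.mkHom₂_apply h1 h2 hV hW

/-! ### Lie derivative and exterior derivative -/

/-- The Lie derivative of a `(0,2)`-tensor field:
`(£_X T)(V, W) = X(T(V, W)) - T([X, V], W) - T(V, [X, W])`. -/
noncomputable def lieDeriv (X : VField E M) (T : Tensor2 E M) : Tensor2 E M := fun x ↦
  tensorOf (fun V W ↦ dirDeriv X (fun y ↦ T y (V y) (W y)) x
    - T x (lieBr X V x) (W x) - T x (V x) (lieBr X W x)) x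

theorem lieDeriv_apply {X : VField E M} {T : Tensor2 E M} {x : M} (hT : T.DiffAt x)
    {V W : VField E M} (hV : V.DiffAt x) (hW : W.DiffAt x) :
    lieDeriv X T x (V x) (W x) = dirDeriv X (fun y ↦ T y (V y) (W y)) x
    - T x (lieBr X V x) (W x) - T x (V x) (lieBr X W x) := by
  rw [lieDeriv, tensorOf_apply _ _ hV hW]
  · intro W hW
    constructor
    · intro f V hf hV
      simp only [Pi.smul_apply', map_smul, _root_.smul_apply, smul_eq_mul, 
        dirDeriv_mul hf (hT.apply hV hW), lieBr_smul_right hf hV, map_add, _root_.add_apply]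
      ring
    · intro V V' hV hV'
      simp only [Pi.add_apply, _root_.add_apply,
        dirDeriv_add (hT.apply hV hW) (hT.apply hV' hW), lieBr_add_right hV hV', map_add]
      ring
  · intro V hV
    constructor
    · intro f W hf hW
      simp only [Pi.smul_apply', map_smul, _root_.smul_apply, smul_eq_mul, 
        dirDeriv_mul hf (hT.apply hV hW), lieBr_smul_right hf hW, map_add, _root_.add_apply]
      ring
    · intro V V' hW hW'
      simp only [Pi.add_apply, _root_.add_apply,
        dirDeriv_add (hT.apply hV hW) (hT.apply hV hW'), lieBr_add_right hW hW', map_add]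
      ring

/-- The exterior derivative of a covector field:
`(dσ)(V, W) = V(σ(W)) - W(σ(V)) - σ([V, W])`. -/
noncomputable def extDeriv (σ : Covector E M) : Tensor2 E M := fun x ↦
  tensorOf (fun V W ↦ dirDeriv V (fun y ↦ σ y (W y)) x - dirDeriv W (fun y ↦ σ y (V y)) x
     - σ x (lieBr V W x)) x

theorem extDeriv_apply {σ : Covector E M} {x : M} (hT : σ.DiffAt x)
    {V W : VField E M} (hV : V.DiffAt x) (hW : W.DiffAt x) :
    extDeriv σ x (V x) (W x) = dirDeriv V (fun y ↦ σ y (W y)) x - dirDeriv W (fun y ↦ σ y (V y)) x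
     - σ x (lieBr V W x) := by
  rw [extDeriv, tensorOf_apply _ _ hV hW]
  · intro W hW
    constructor
    · intro f V hf hV
      simp only [Pi.smul_apply', map_smul, _root_.smul_apply, smul_eq_mul, dirDeriv_smul_left,
        dirDeriv_mul hf (hT.apply hV), lieBr_smul_left hf hV, map_add, _root_.add_apply]
      ring
    · intro V V' hV hV'
      simp only [Pi.add_apply, _root_.add_apply, dirDeriv_add_left,
        dirDeriv_add (hT.apply hV) (hT.apply hV'), lieBr_add_left hV hV', map_add]
      ring
  · intro V hV
    constructor
    · intro f W hf hW
      simp only [Pi.smul_apply', map_smul, _root_.smul_apply, smul_eq_mul, dirDeriv_smul_left,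
        dirDeriv_mul hf (hT.apply hW), lieBr_smul_right hf hW, map_add, _root_.add_apply]
      ring
    · intro V V' hW hW'
      simp only [Pi.add_apply, _root_.add_apply, dirDeriv_add_left,
        dirDeriv_add (hT.apply hW) (hT.apply hW'), lieBr_add_right hW hW', map_add]
      ring

/-! ### Connections -/

/-- Affine connections; `nab Z x (X x)` is the value of `∇_X Z` at `x`. -/
abbrev Connection (E : Type*) [NormedAddCommGroup E] [NormedSpace ℝ E]
    (M : Type*) [TopologicalSpace M] [ChartedSpace E M] [IsManifold 𝓘(ℝ, E) ∞ M] :=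
  CovariantDerivative 𝓘(ℝ, E) E (TangentSpace 𝓘(ℝ, E) : M → Type _)

/-- The covariant derivative of a covector field:
`(∇σ)(X, Z) = (∇_X σ)(Z) = X(σ(Z)) - σ(∇_X Z)`, in index notation `∇_a σ_b`. -/
noncomputable def covDeriv (nab : Connection E M) (σ : Covector E M) : Tensor2 E M := fun x ↦
  tensorOf (fun X Z ↦ dirDeriv X (fun y ↦ σ y (Z y)) x - σ x (nab Z x (X x))) x

theorem covDeriv_apply {nab : Connection E M} {σ : Covector E M} {x : M} (hT : σ.DiffAt x)
    {V W : VField E M} (hV : V.DiffAt x) (hW : W.DiffAt x) :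
    covDeriv nab σ x (V x) (W x) =
      dirDeriv V (fun y ↦ σ y (W y)) x - σ x (nab W x (V x)) := by
  rw [covDeriv, tensorOf_apply _ _ hV hW]
  · intro W hW
    constructor
    · intro f V hf hV
      simp only [Pi.smul_apply', map_smul, smul_eq_mul, dirDeriv_smul_left]
      ring
    · intro V V' hV hV'
      simp only [Pi.add_apply, dirDeriv_add_left, map_add]
      ring
  · intro V hV
    constructor
    · intro f W hf hW
      simp only [nab.isCovariantDerivativeOn.leibniz hW hf, Pi.smul_apply', map_smul, smul_eq_mul,
        dirDeriv_mul hf (hT.apply hW), map_add, _root_.add_apply,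
        _root_.smul_apply, ContinuousLinearMap.smulRight_apply]
      simp only [dirDeriv]
      ring
    · intro W W' hW hW'
      simp only [nab.isCovariantDerivativeOn.add hW hW', Pi.add_apply,
        dirDeriv_add (hT.apply hW) (hT.apply hW'), map_add, _root_.add_apply]
      ring

/-- The Lie derivative `£_η ∇` of a connection, evaluated on two vector fields:
`(£_η ∇)(X, W) = £_η (∇_X W) - ∇_X (£_η W) - ∇_{£_η X} W`. -/
noncomputable def lieConnection (nab : Connection E M) (η X W : VField E M) : VField E M := fun x ↦
  lieBr η (fun y ↦ nab W y (X y)) x - nab (lieBr η W) x (X x) - nab W x (lieBr η X x)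

/-- The right-hand side of the Koszul formula for a symmetric `(0,2)`-tensor `T`. -/
noncomputable def koszul (T : Tensor2 E M) (Z X W : VField E M) (x : M) : ℝ :=
  (1/2) * (dirDeriv X (fun y ↦ T y (Z y) (W y)) x + dirDeriv Z (fun y ↦ T y (W y) (X y)) x
    - dirDeriv W (fun y ↦ T y (X y) (Z y)) x + T x (lieBr X Z x) (W x) - T x (lieBr Z W x) (X x)
    + T x (lieBr W X x) (Z x))

/-- The tensor `(X, W) ↦ koszul T Z X W` for a fixed vector field `Z`. -/
noncomputable def koszulT (T : Tensor2 E M) (Z : VField E M) : Tensor2 E M := fun x ↦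
  tensorOf (fun X W ↦ koszul T Z X W x) x

theorem koszulT_apply {T : Tensor2 E M} {x : M} (hT : T.DiffAt x) (hs : ∀ y v w, T y v w = T y w v)
    {Z X W : VField E M} (hZ : Z.DiffAt x) (hX : X.DiffAt x) (hW : W.DiffAt x) :
    koszulT T Z x (X x) (W x) = koszul T Z X W x := by
  rw [koszulT, tensorOf_apply _ _ hX hW]
  · intro W hW
    constructor
    · intro f V hf hV
      simp only [koszul, Pi.smul_apply', map_smul, _root_.smul_apply, smul_eq_mul, dirDeriv_smul_left,
        dirDeriv_mul hf (hT.apply hV hZ), dirDeriv_mul hf (hT.apply hW hV), lieBr_smul_left hf hV, lieBr_smul_right hf hV, map_add, _root_.add_apply, hs x (W x) (V x), hs x (Z x)]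
      ring
    · intro V V' hV hV'
      simp only [koszul, Pi.add_apply, _root_.add_apply, dirDeriv_add_left,
        dirDeriv_add (hT.apply hV hZ) (hT.apply hV' hZ), dirDeriv_add (hT.apply hW hV) (hT.apply hW hV'), lieBr_add_left hV hV',lieBr_add_right hV hV', map_add]
      ring
  · intro X hX
    constructor
    · intro f V hf hV
      simp only [koszul, Pi.smul_apply', map_smul, _root_.smul_apply, smul_eq_mul, dirDeriv_smul_left,
        dirDeriv_mul hf (hT.apply hV hX), dirDeriv_mul hf (hT.apply hZ hV), lieBr_smul_left hf hV, lieBr_smul_right hf hV, map_add, _root_.add_apply, hs x (V x) (Z x)]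
      ring
    · intro V V' hV hV'
      simp only [koszul, Pi.add_apply, _root_.add_apply, dirDeriv_add_left,
        dirDeriv_add (hT.apply hV hX) (hT.apply hV' hX), dirDeriv_add (hT.apply hZ hV) (hT.apply hZ hV'), lieBr_add_left hV hV',lieBr_add_right hV hV', map_add]
      ring


theorem koszul_leibniz {T : Tensor2 E M} {x : M} (hT : T.DiffAt x) (hs : ∀ y v w, T y v w = T y w v)
    {f : M → ℝ} (hf : MDifferentiableAt 𝓘(ℝ, E) 𝓘(ℝ, ℝ) f x)
    {Z X W : VField E M} (hZ : Z.DiffAt x) (hX : X.DiffAt x) (hW : W.DiffAt x) :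
    koszul T (f • Z) X W x = f x * koszul T Z X W x + dirDeriv X f x * T x (Z x) (W x) := by
  simp only [koszul, Pi.smul_apply', map_smul, _root_.smul_apply, smul_eq_mul, dirDeriv_smul_left,
        dirDeriv_mul hf (hT.apply hZ hW), dirDeriv_mul hf (hT.apply hX hZ), lieBr_smul_left hf hZ, lieBr_smul_right hf hZ, map_add, _root_.add_apply, hs x (Z x) (X x)]
  ring

theorem koszul_add {T : Tensor2 E M} {x : M} (hT : T.DiffAt x) 
    {Z Z' X W : VField E M} (hZ : Z.DiffAt x) (hZ' : Z'.DiffAt x) (hX : X.DiffAt x) (hW : W.DiffAt x) :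
    koszul T (Z + Z') X W x = koszul T Z X W x + koszul T Z' X W x := by
  simp only [koszul, Pi.add_apply, _root_.add_apply, dirDeriv_add_left,
        dirDeriv_add (hT.apply hZ hW) (hT.apply hZ' hW), dirDeriv_add (hT.apply hX hZ) (hT.apply hX hZ'), lieBr_add_left hZ hZ',lieBr_add_right hZ hZ', map_add]
  ring

theorem koszul_torsion {T : Tensor2 E M} {x : M} (hs : ∀ y v w, T y v w = T y w v)
    (Z X W : VField E M) : koszul T Z X W x - koszul T X Z W x = T x (lieBr X Z x) (W x) := by
  simp only [koszul, lieBr_swap Z X, lieBr_swap W X, lieBr_swap Z W, map_neg, _root_.neg_apply,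
    hs _ (X _), hs _ (W _) (Z _)]
  ring

theorem koszul_metric {T : Tensor2 E M} {x : M} (hs : ∀ y v w, T y v w = T y w v)
    (Z X W : VField E M) : koszul T Z X W x + koszul T W X Z x = dirDeriv X (fun y ↦ T y (Z y) (W y)) x := by
  simp only [koszul, lieBr_swap Z X, lieBr_swap W X, lieBr_swap Z W, map_neg, _root_.neg_apply,
    hs _ (X _), hs _ (W _) (Z _)]
  ring

/-! ### Linear algebra -/

theorem sig_apply {V : Type*} [AddCommGroup V] [Module ℝ V] [TopologicalSpace V] {ε : ℝ} {B : V →L[ℝ] V →L[ℝ] ℝ}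
   {m : ℕ} {b : Module.Basis (Fin (m + 1)) ℝ V} (h : ∀ i j, B (b i) (b j) = if i = j then (if i = 0 then ε else 1) else 0) (v : V) (j) :
   B v (b j) = b.repr v j * if j = 0 then ε else 1 := by
  have := congrArg (fun u ↦ B u (b j)) (b.sum_repr v)
  simp only [map_sum, map_smul, _root_.sum_apply, _root_.smul_apply, h] at this
  rw [← this]
  simp

theorem invertible_of_injective {V : Type*} [AddCommGroup V] [Module ℝ V] [TopologicalSpace V] [IsTopologicalAddGroup V] [ContinuousSMul ℝ V] [T2Space V] [FiniteDimensional ℝ V] {B : V →L[ℝ] V →L[ℝ] ℝ}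
   (h : ∀ v, B v = 0 → v = 0) : B.IsInvertible := by
  have hinj : Function.Injective B := (injective_iff_map_eq_zero B).2 h
  let e : (V →L[ℝ] ℝ) ≃ₗ[ℝ] (V →ₗ[ℝ] ℝ) := LinearMap.toContinuousLinearMap.symm
  let B' : V →ₗ[ℝ] (V →ₗ[ℝ] ℝ) := e.toLinearMap ∘ₗ B.toLinearMap
  have hB' : Function.Injective B' := e.injective.comp hinj
  let e2 : V ≃ₗ[ℝ] (V →ₗ[ℝ] ℝ) := LinearEquiv.ofInjectiveOfFinrankEq B' hB' (Subspace.dual_finrank_eq (K := ℝ) (V := V)).symm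
  let e3 : V ≃L[ℝ] (V →L[ℝ] ℝ) := (e2.trans e.symm).toContinuousLinearEquiv
  refine ⟨e3, ?_⟩
  ext v w
  rfl

/-! ### Lorentzian metrics and the Levi-Civita connection -/

/-- Smooth metrics of signature `(-, +, …, +)`; a spacetime is a manifold with such a metric. -/
structure LorentzMetric (E : Type*) [NormedAddCommGroup E] [NormedSpace ℝ E] (M : Type*)
    [TopologicalSpace M] [ChartedSpace E M] [IsManifold 𝓘(ℝ, E) ∞ M] where
  /-- The metric tensor. -/
  g : Tensor2 E M
  symm : ∀ x v w, g x v w = g x w v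
  smooth : g.Smooth
  signature : ∀ x, HasSignature (-1) (g x)

/-- `nab` is torsion-free and compatible with the metric. -/
structure IsLeviCivita (G : LorentzMetric E M) (nab : Connection E M) : Prop where
  torsion_free : ∀ (X Z : VField E M) (x : M), X.DiffAt x → Z.DiffAt x →
    nab Z x (X x) - nab X x (Z x) = lieBr X Z x
  metric : ∀ (X Z W : VField E M) (x : M), X.DiffAt x → Z.DiffAt x → W.DiffAt x →
    dirDeriv X (fun y ↦ G.g y (Z y) (W y)) x
      - G.g x (nab Z x (X x)) (W x) - G.g x (Z x) (nab W x (X x)) = 0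

theorem LorentzMetric.inj (G : LorentzMetric E M) (x : M) (v) (h : G.g x v = 0) : v = 0 := by
  obtain ⟨m, b, hb⟩ := G.signature x
  rw [← b.sum_repr v]
  refine Finset.sum_eq_zero fun j _ => ?_
  have := sig_apply hb v j
  rw [h] at this
  split_ifs at this <;> simp_all

open Classical in
theorem exists_leviCivita (G : LorentzMetric E M) : ∃ nab, IsLeviCivita G nab := by
  have hG : ∀ x, Tensor2.DiffAt G.g x := fun x ↦ G.smooth.diffAt x
  let L (Z : VField E M) (x : M) : TangentSpace 𝓘(ℝ, E) x →L[ℝ] TangentSpace 𝓘(ℝ, E) x :=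
    if Z.DiffAt x then (G.g x).inverse ∘L koszulT G.g Z x else 0
  have hinv : ∀ x, (G.g x).IsInvertible := fun x ↦ by
    have : FiniteDimensional ℝ (TangentSpace 𝓘(ℝ, E) x) := inferInstanceAs (FiniteDimensional ℝ E)
    have : T2Space (TangentSpace 𝓘(ℝ, E) x) := inferInstanceAs (T2Space E)
    exact invertible_of_injective (G.inj x)
  have key : ∀ (X Z W : VField E M) (x : M), X.DiffAt x → Z.DiffAt x → W.DiffAt x →
      G.g x (L Z x (X x)) (W x) = koszul G.g Z X W x := by
    intro X Z W x hX hZ hW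
    rw [← koszulT_apply (hG x) G.symm hZ hX hW]
    simp only [L, if_pos hZ, ContinuousLinearMap.comp_apply]
    rw [← ContinuousLinearMap.comp_apply (G.g x), (hinv x).self_comp_inverse]
    rfl
  have uniq : ∀ (x : M) (v w : TangentSpace 𝓘(ℝ, E) x), (∀ W : VField E M, W.DiffAt x → G.g x v (W x) = G.g x w (W x)) → v = w := by
    intro x v w h
    refine sub_eq_zero.1 (G.inj x _ ?_)
    ext u
    obtain ⟨V, hV, rfl⟩ := exists_field u
    simp [h V hV]
  refine ⟨⟨L, ⟨?_, ?_⟩⟩, ⟨?_, ?_⟩⟩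
  · intro Z Z' x hZ hZ' _
    ext u
    obtain ⟨X, hX, rfl⟩ := exists_field u
    refine uniq x _ _ fun W hW => ?_
    rw [key X _ W x hX (VField.DiffAt.add hZ hZ') hW, koszul_add (hG x) hZ hZ' hX hW]
    simp only [_root_.add_apply, map_add]
    rw [key X _ W x hX hZ hW, key X _ W x hX hZ' hW]
  · intro Z f x hZ hf _
    ext u
    obtain ⟨X, hX, rfl⟩ := exists_field u
    refine uniq x _ _ fun W hW => ?_
    rw [key X _ W x hX (VField.DiffAt.smul hf hZ) hW, koszul_leibniz (hG x) G.symm hf hZ hX hW, ← key X _ W x hX hZ hW]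
    simp [dirDeriv]
  · intro X Z x hX hZ
    refine uniq x _ _ fun W hW => ?_
    rw [← koszul_torsion G.symm, map_sub, _root_.sub_apply]
    exact congrArg₂ _ (key X Z W x hX hZ hW) (key Z X W x hZ hX hW)
  · intro X Z W x hX hZ hW
    rw [G.symm x (Z x), ← koszul_metric G.symm, ← key X Z W x hX hZ hW, ← key X W Z x hX hW hZ]
    change _ - G.g x (L _ _ _) _ - G.g x (L _ _ _) _ = 0
    ring


/-- The Levi-Civita connection of a Lorentzian metric. -/
noncomputable def LorentzMetric.leviCivita (G : LorentzMetric E M) : Connection E M :=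
  (exists_leviCivita G).choose

theorem LorentzMetric.isLeviCivita (G : LorentzMetric E M) : IsLeviCivita G G.leviCivita :=
  (exists_leviCivita G).choose_spec

/-! ## Null hypersurface data -/

/-- Null metric hypersurface data `{N, γ, ℓ, ℓ⁽²⁾}`. -/
structure NullMetricData (E : Type*) [NormedAddCommGroup E] [NormedSpace ℝ E] (M : Type*)
    [TopologicalSpace M] [ChartedSpace E M] [IsManifold 𝓘(ℝ, E) ∞ M] where
  /-- A symmetric tensor of signature `(0, +, …, +)`. -/
  γ : Tensor2 E M
  γ_symm : ∀ x v w, γ x v w = γ x w v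
  γ_smooth : γ.Smooth
  γ_signature : ∀ x, HasSignature 0 (γ x)
  /-- The covector `ℓ`. -/
  ell : Covector E M
  ell_smooth : ell.Smooth
  /-- The scalar `ℓ⁽²⁾`. -/
  ell2 : M → ℝ
  ell2_smooth : ContMDiff 𝓘(ℝ, E) 𝓘(ℝ, ℝ) ∞ ell2
  /-- The symmetric form
  `A((W, a), (Z, b)) = γ(W, Z) + a ℓ(Z) + b ℓ(W) + a b ℓ⁽²⁾` on `T_x N × ℝ` is non-degenerate. -/
  nondegenerate : ∀ (x : M) (W : TangentSpace 𝓘(ℝ, E) x) (a : ℝ),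
    (∀ (Z : TangentSpace 𝓘(ℝ, E) x) (b : ℝ),
      γ x W Z + a * ell x Z + b * ell x W + a * b * ell2 x = 0) → W = 0 ∧ a = 0

/-- Null hypersurface data `{N, γ, ℓ, ℓ⁽²⁾, Y}`. -/
structure NullHypersurfaceData (E : Type*) [NormedAddCommGroup E] [NormedSpace ℝ E] (M : Type*)
    [TopologicalSpace M] [ChartedSpace E M] [IsManifold 𝓘(ℝ, E) ∞ M]
    extends NullMetricData E M where
  /-- A symmetric tensor. -/
  Y : Tensor2 E M
  Y_symm : ∀ x v w, Y x v w = Y x w v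
  Y_smooth : Y.Smooth

namespace NullMetricData

variable (D : NullMetricData E M)

/-- The covector `(Z, b) ↦ b` on `T_x N × ℝ` is `A`-dual to a (unique) vector `(W, c)`. -/
theorem exists_n (x : M) : ∃ (W : TangentSpace 𝓘(ℝ, E) x) (c : ℝ), 
    ∀ (Z : TangentSpace 𝓘(ℝ, E) x) (b : ℝ), D.γ x W Z + c * D.ell x Z + b * D.ell x W + c * b * D.ell2 x = b := by
  obtain ⟨m, b, hb⟩ := D.γ_signature x
  have h0 : ∀ Z, D.γ x (b 0) Z = 0 := fun Z ↦ by
    rw [D.γ_symm, sig_apply hb]; simp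
  have h1 : D.ell x (b 0) ≠ 0 := fun h ↦ b.ne_zero 0 (D.nondegenerate x (b 0) 0 (by simp [h0, h])).1
  exact ⟨(D.ell x (b 0))⁻¹ • b 0, 0, by simp [h0, h1]⟩

/-- The vector field `n`. For the inverse `A♯` of the form `A` one has
`A♯((α, a), (β, b)) = P(α, β) + a n(β) + b n(α)`; hence `n` is the tangential part of the vector
of `T_x N × ℝ` which is `A`-dual to the covector `(Z, b) ↦ b`. -/
noncomputable def n : VField E M := fun x ↦ (D.exists_n x).choose

/-- `γ(n, ·) = 0` and `ℓ(n) = 1`. -/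
theorem n_spec (x : M) : (∀ Z, D.γ x (D.n x) Z = 0) ∧ D.ell x (D.n x) = 1 := by
  obtain ⟨c, hc⟩ := (D.exists_n x).choose_spec
  change ∀ Z b, D.γ x (D.n x) Z + c * D.ell x Z + b * D.ell x (D.n x) + c * b * D.ell2 x = b at hc
  obtain ⟨m, b, hb⟩ := D.γ_signature x
  have h0 : ∀ Z, D.γ x (b 0) Z = 0 := fun Z ↦ by
    rw [D.γ_symm, sig_apply hb]; simp
  have h1 : D.ell x (b 0) ≠ 0 := fun h ↦ b.ne_zero 0 (D.nondegenerate x (b 0) 0 (by simp [h0, h])).1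
  have h2 := hc (b 0) 0
  rw [D.γ_symm, h0] at h2
  have hc0 : c = 0 := by simpa [h1] using h2
  subst hc0
  refine ⟨fun Z ↦ by simpa using hc Z 0, by simpa using hc 0 1⟩

theorem inj {x : M} {v : TangentSpace 𝓘(ℝ, E) x} (h : D.γ x v v = 0) (h' : D.ell x v = 0) : v = 0 := by
  obtain ⟨m, b, hb⟩ := D.γ_signature x
  have h0 : ∀ Z, D.γ x (b 0) Z = 0 := fun Z ↦ by
    rw [D.γ_symm, sig_apply hb]; simp
  have h1 : D.ell x (b 0) ≠ 0 := fun h ↦ b.ne_zero 0 (D.nondegenerate x (b 0) 0 (by simp [h0, h])).1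
  have h2 : D.γ x v v = ∑ j, (if j = 0 then 0 else b.repr v j ^ 2) := by
    have := congrArg (fun u ↦ D.γ x v u) (b.sum_repr v)
    simp only [map_sum, map_smul, sig_apply hb] at this
    rw [← this]
    refine Finset.sum_congr rfl fun j _ ↦ ?_
    split_ifs <;> simp [sq]
  rw [h2, Finset.sum_eq_zero_iff_of_nonneg (fun j _ ↦ by split_ifs <;> positivity)] at h
  have h3 : v = b.repr v 0 • b 0 := by
    conv_lhs => rw [← b.sum_repr v]
    rw [Finset.sum_eq_single 0]
    · intro j _ hj
      have := h j (Finset.mem_univ _)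
      simp only [hj, if_false] at this
      simp [pow_eq_zero_iff] at this
      simp [this]
    · simp
  rw [h3] at h' ⊢
  simp only [map_smul, smul_eq_mul, mul_eq_zero, h1, or_false] at h'
  simp [h']

theorem psd (x : M) (v) : 0 ≤ D.γ x v v := by
  obtain ⟨m, b, hb⟩ := D.γ_signature x
  have h2 : D.γ x v v = ∑ j, (if j = 0 then 0 else b.repr v j ^ 2) := by
    have := congrArg (fun u ↦ D.γ x v u) (b.sum_repr v)
    simp only [map_sum, map_smul, sig_apply hb] at this
    rw [← this]
    refine Finset.sum_congr rfl fun j _ ↦ ?_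
    split_ifs <;> simp [sq]
  rw [h2]
  exact Finset.sum_nonneg fun j _ ↦ by split_ifs <;> positivity

set_option synthInstance.maxHeartbeats 200000 in
theorem n_smooth : ContMDiff 𝓘(ℝ, E) (𝓘(ℝ, E).prod 𝓘(ℝ, E)) ∞ (fun y ↦ (⟨y, D.n y⟩ : TangentBundle 𝓘(ℝ, E) M)) := by
  intro x₀
  have hγ := ((contMDiffAt_hom_bundle _).1 (D.γ_smooth x₀)).2
  have hl := ((contMDiffAt_hom_bundle _).1 (D.ell_smooth x₀)).2
  simp only at hγ hl
  set γc : M → E →L[ℝ] E →L[ℝ] ℝ := fun x ↦ ContinuousLinearMap.inCoordinates E (TangentSpace 𝓘(ℝ, E)) (E →L[ℝ] ℝ) (fun x : M ↦ TangentSpace 𝓘(ℝ, E) x →L[ℝ] ℝ) x₀ x x₀ x (D.γ x) with hγc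
  set lc : M → E →L[ℝ] ℝ := fun x ↦ ContinuousLinearMap.inCoordinates E (TangentSpace 𝓘(ℝ, E)) ℝ (Bundle.Trivial M ℝ) x₀ x x₀ x (D.ell x) with hlc
  let e := trivializationAt E (TangentSpace 𝓘(ℝ, E)) x₀
  have he : e.baseSet ∈ 𝓝 x₀ := e.open_baseSet.mem_nhds (FiberBundle.mem_baseSet_trivializationAt' _)
  have hγ' : ∀ x ∈ e.baseSet, ∀ v w, γc x v w = D.γ x (e.symm x v) (e.symm x w) := by
    intro x hx v w
    have := inCoordinates_apply_eq₂ (ϕ := D.γ x) (v := v) (w := w) (x₀ := x₀) (𝕜 := ℝ) (F₁ := E) (F₂ := E) (F₃ := ℝ) (E₁ := TangentSpace 𝓘(ℝ, E)) (E₂ := TangentSpace 𝓘(ℝ, E)) (E₃ := Bundle.Trivial M ℝ) hx hx (by simp)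
    simpa using this
  have hl' : ∀ x ∈ e.baseSet, ∀ v, lc x v = D.ell x (e.symm x v) := by
    intro x hx v
    simp only [hlc]
    rw [ContinuousLinearMap.inCoordinates_eq hx (by simp)]
    rfl
  have hiff : ContMDiffAt 𝓘(ℝ, E) (𝓘(ℝ, E).prod 𝓘(ℝ, E)) ∞ (fun y ↦ (⟨y, D.n y⟩ : TangentBundle 𝓘(ℝ, E) M)) x₀ ↔ _ := contMDiffAt_section _
  rw [hiff]
  let H : M → E →L[ℝ] E →L[ℝ] ℝ := fun x ↦ γc x + (lc x).smulRight (lc x)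
  have hH : ContMDiffAt 𝓘(ℝ, E) 𝓘(ℝ, E →L[ℝ] E →L[ℝ] ℝ) ∞ H x₀ := by
    have h1 : ContDiff ℝ ∞ (fun l : E →L[ℝ] ℝ ↦ l.smulRight l) :=
      contDiff_id.smulRight contDiff_id
    exact hγ.add (h1.contMDiff.contMDiffAt.comp x₀ hl)
  have hinv : ∀ x ∈ e.baseSet, (H x).IsInvertible := by
    intro x hx
    refine invertible_of_injective fun v hv ↦ ?_
    have := congrArg (fun f ↦ f v) hv
    simp only [H, _root_.add_apply, ContinuousLinearMap.smulRight_apply, 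
      _root_.smul_apply, hγ' x hx, hl' x hx, _root_.zero_apply, smul_eq_mul] at this
    have h2 := D.psd x (e.symm x v)
    have h3 : e.symm x v = 0 := D.inj (by nlinarith) (by nlinarith)
    rw [← e.continuousLinearMapAt_symmL (R := ℝ) hx v, Trivialization.symmL_apply, h3, map_zero]
    exact hx
  have hN : ContMDiffAt 𝓘(ℝ, E) 𝓘(ℝ, E) ∞ (fun x ↦ (H x).inverse (lc x)) x₀ := by
    have h1 : ContDiffAt ℝ ∞ (ContinuousLinearMap.inverse : (E →L[ℝ] E →L[ℝ] ℝ) → _) (H x₀) :=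
      (hinv x₀ (FiberBundle.mem_baseSet_trivializationAt' _)).contDiffAt_map_inverse
    have h2 : ContMDiffAt 𝓘(ℝ, E) 𝓘(ℝ, (E →L[ℝ] ℝ) →L[ℝ] E) ∞ (fun x ↦ (H x).inverse) x₀ :=
      h1.contMDiffAt.comp x₀ hH
    exact h2.clm_apply hl
  refine hN.congr_of_eventuallyEq ?_
  filter_upwards [he] with x hx
  symm
  rw [(hinv x hx).inverse_apply_eq]
  ext w
  obtain ⟨hn1, hn2⟩ := D.n_spec x
  simp only [H, _root_.add_apply, ContinuousLinearMap.smulRight_apply,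
      _root_.smul_apply, hγ' x hx, hl' x hx, smul_eq_mul]
  rw [e.symm_apply_apply_mk hx, hn1, hn2]
  simp
theorem n_diffAt (x : M) : D.n.DiffAt x := (D.n_smooth x).mdifferentiableAt (by simp)

/-- `U = ½ £_n γ`. -/
noncomputable def U : Tensor2 E M := fun x ↦ (1 / 2 : ℝ) • lieDeriv D.n D.γ x

/-- `F = ½ dℓ`. -/
noncomputable def F : Tensor2 E M := fun x ↦ (1 / 2 : ℝ) • extDeriv D.ell x

/-- `s = F(n, ·)`. -/
noncomputable def s : Covector E M := fun x ↦ D.F x (D.n x)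

/-- The defining conditions of the metric hypersurface connection `∇°`: it is torsion-free and
`∇°_a γ_bc = - ℓ_b U_ac - ℓ_c U_ab`, `∇°_a ℓ_b = F_ab - ℓ⁽²⁾ U_ab`. -/
structure IsMetricHypersurfaceConnection (nab : Connection E M) : Prop where
  torsion_free : ∀ (X Z : VField E M) (x : M), X.DiffAt x → Z.DiffAt x →
    nab Z x (X x) - nab X x (Z x) = lieBr X Z x
  nabla_γ : ∀ (X Z W : VField E M) (x : M), X.DiffAt x → Z.DiffAt x → W.DiffAt x →
    dirDeriv X (fun y ↦ D.γ y (Z y) (W y)) x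
      - D.γ x (nab Z x (X x)) (W x) - D.γ x (Z x) (nab W x (X x)) =
    - D.ell x (Z x) * D.U x (X x) (W x) - D.ell x (W x) * D.U x (X x) (Z x)
  nabla_ell : ∀ (X Z : VField E M) (x : M), X.DiffAt x → Z.DiffAt x →
    dirDeriv X (fun y ↦ D.ell y (Z y)) x - D.ell x (nab Z x (X x)) =
      D.F x (X x) (Z x) - D.ell2 x * D.U x (X x) (Z x)

theorem U_symm (x : M) (v w : TangentSpace 𝓘(ℝ, E) x) : D.U x v w = D.U x w v := by
  obtain ⟨V, hV, rfl⟩ := exists_field v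
  obtain ⟨W, hW, rfl⟩ := exists_field w
  simp only [U, _root_.smul_apply, lieDeriv_apply (D.γ_smooth.diffAt x) hV hW,
    lieDeriv_apply (D.γ_smooth.diffAt x) hW hV, D.γ_symm _ (V _), D.γ_symm _ (W x) (lieBr _ _ _)]
  ring_nf

theorem F_antisymm (x : M) (v w : TangentSpace 𝓘(ℝ, E) x) : D.F x v w = - D.F x w v := by
  obtain ⟨V, hV, rfl⟩ := exists_field v
  obtain ⟨W, hW, rfl⟩ := exists_field w
  simp only [F, _root_.smul_apply, extDeriv_apply (D.ell_smooth.diffAt x) hV hW,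
    extDeriv_apply (D.ell_smooth.diffAt x) hW hV, lieBr_swap W V, map_neg, smul_eq_mul]
  ring

theorem koszul_n {X Z : VField E M} {x : M} (hX : X.DiffAt x) (hZ : Z.DiffAt x) :
    koszul D.γ Z X D.n x = - D.U x (X x) (Z x) := by
  have h1 : ∀ y v, D.γ y (D.n y) v = 0 := fun y ↦ (D.n_spec y).1
  have h2 : ∀ y v, D.γ y v (D.n y) = 0 := fun y v ↦ by rw [D.γ_symm, h1]
  have h3 : ∀ V : VField E M, dirDeriv V (fun _ ↦ (0 : ℝ)) x = 0 := fun V ↦ by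
    simp [dirDeriv, mvfderiv_const]
  simp only [U, _root_.smul_apply, lieDeriv_apply (D.γ_smooth.diffAt x) hX hZ, koszul,
    h1, h2, h3, lieBr_swap Z D.n, map_neg, _root_.neg_apply, smul_eq_mul,
    D.γ_symm x (X x) (lieBr _ _ _)]
  ring

open Classical in
theorem exists_metricHypersurfaceConnection :
    ∃ nab : Connection E M, D.IsMetricHypersurfaceConnection nab := by
  have hγ : ∀ x, Tensor2.DiffAt D.γ x := fun x ↦ D.γ_smooth.diffAt x
  have hl : ∀ x, Covector.DiffAt D.ell x := fun x ↦ D.ell_smooth.diffAt x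
  let H : Tensor2 E M := fun x ↦ D.γ x + (D.ell x).smulRight (D.ell x)
  let C (Z : VField E M) : Covector E M := fun x ↦
    (1 + D.ell2 x) • D.U x (Z x) + mvfderiv 𝓘(ℝ, E) (fun y ↦ D.ell y (Z y)) x + D.F x (Z x)
  let L (Z : VField E M) (x : M) : TangentSpace 𝓘(ℝ, E) x →L[ℝ] TangentSpace 𝓘(ℝ, E) x :=
    if Z.DiffAt x then (H x).inverse ∘L (koszulT D.γ Z x + (C Z x).smulRight (D.ell x)) else 0
  have hinv : ∀ x, (H x).IsInvertible := fun x ↦ by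
    have : FiniteDimensional ℝ (TangentSpace 𝓘(ℝ, E) x) := inferInstanceAs (FiniteDimensional ℝ E)
    have : T2Space (TangentSpace 𝓘(ℝ, E) x) := inferInstanceAs (T2Space E)
    refine invertible_of_injective fun v hv ↦ ?_
    have h1 := congrArg (fun f ↦ f v) hv
    simp only [H, _root_.add_apply, ContinuousLinearMap.smulRight_apply,
      _root_.smul_apply, _root_.zero_apply, smul_eq_mul] at h1
    have h2 := D.psd x v
    exact D.inj (by nlinarith) (by nlinarith)
  have key0 : ∀ (X Z W : VField E M) (x : M), X.DiffAt x → Z.DiffAt x → W.DiffAt x →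
      D.γ x (L Z x (X x)) (W x) + D.ell x (L Z x (X x)) * D.ell x (W x)
        = koszul D.γ Z X W x + C Z x (X x) * D.ell x (W x) := by
    intro X Z W x hX hZ hW
    rw [← koszulT_apply (hγ x) D.γ_symm hZ hX hW]
    have h1 : H x (L Z x (X x)) = (koszulT D.γ Z x + (C Z x).smulRight (D.ell x)) (X x) := by
      simp only [L, if_pos hZ, ContinuousLinearMap.comp_apply]
      rw [← ContinuousLinearMap.comp_apply (H x), (hinv x).self_comp_inverse]
      rfl
    have h2 := congrArg (fun f ↦ f (W x)) h1
    simpa [H] using h2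
  have key1 : ∀ (X Z : VField E M) (x : M), X.DiffAt x → Z.DiffAt x →
      D.ell x (L Z x (X x)) = dirDeriv X (fun y ↦ D.ell y (Z y)) x - D.F x (X x) (Z x)
        + D.ell2 x * D.U x (X x) (Z x) := by
    intro X Z x hX hZ
    have h1 := key0 X Z D.n x hX hZ (D.n_diffAt x)
    rw [D.koszul_n hX hZ, (D.n_spec x).2, D.γ_symm, (D.n_spec x).1] at h1
    simp only [C, _root_.add_apply, _root_.smul_apply, smul_eq_mul,
      D.F_antisymm x (Z x), D.U_symm x (Z x)] at h1
    simp only [dirDeriv]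
    linarith
  have key2 : ∀ (X Z W : VField E M) (x : M), X.DiffAt x → Z.DiffAt x → W.DiffAt x →
      D.γ x (L Z x (X x)) (W x) =
        koszul D.γ Z X W x + D.ell x (W x) * D.U x (X x) (Z x) := by
    intro X Z W x hX hZ hW
    have h1 := key0 X Z W x hX hZ hW
    rw [key1 X Z x hX hZ] at h1
    simp only [C, _root_.add_apply, _root_.smul_apply, smul_eq_mul,
      D.F_antisymm x (Z x), D.U_symm x (Z x), dirDeriv] at h1
    linarith
  have uniq : ∀ (x : M) (v w : TangentSpace 𝓘(ℝ, E) x),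
      (∀ W : VField E M, W.DiffAt x → D.γ x v (W x) = D.γ x w (W x)) →
      D.ell x v = D.ell x w → v = w := by
    intro x v w h h'
    refine sub_eq_zero.1 (D.inj ?_ (by rw [map_sub, h', sub_self]))
    obtain ⟨V, hV, hVe⟩ := exists_field (v - w)
    have h3 := h V hV
    rw [hVe] at h3
    rw [map_sub (D.γ x), _root_.sub_apply, h3, sub_self]
  refine ⟨⟨L, ⟨?_, ?_⟩⟩, ⟨?_, ?_, ?_⟩⟩
  · intro Z Z' x hZ hZ' _
    ext u
    obtain ⟨X, hX, rfl⟩ := exists_field u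
    have hs := VField.DiffAt.add hZ hZ'
    refine uniq x _ _ (fun W hW ↦ ?_) ?_
    · rw [key2 X _ W x hX hs hW, koszul_add (hγ x) hZ hZ' hX hW]
      simp only [_root_.add_apply, map_add, Pi.add_apply]
      rw [key2 X _ W x hX hZ hW, key2 X _ W x hX hZ' hW]
      ring
    · rw [key1 X _ x hX hs]
      simp only [_root_.add_apply, map_add, Pi.add_apply]
      rw [key1 X _ x hX hZ, key1 X _ x hX hZ', dirDeriv_add ((hl x).apply hZ) ((hl x).apply hZ')]
      ring
  · intro Z f x hZ hf _
    ext u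
    obtain ⟨X, hX, rfl⟩ := exists_field u
    have hs := VField.DiffAt.smul hf hZ
    refine uniq x _ _ (fun W hW ↦ ?_) ?_
    · rw [key2 X _ W x hX hs hW, koszul_leibniz (hγ x) D.γ_symm hf hZ hX hW]
      simp only [_root_.add_apply, _root_.smul_apply, map_add, map_smul,
        Pi.smul_apply', smul_eq_mul, ContinuousLinearMap.smulRight_apply]
      rw [key2 X _ W x hX hZ hW]
      simp only [dirDeriv]
      ring
    · rw [key1 X _ x hX hs]
      simp only [_root_.add_apply, _root_.smul_apply, map_add, map_smul,
        Pi.smul_apply', smul_eq_mul, ContinuousLinearMap.smulRight_apply]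
      rw [key1 X _ x hX hZ, dirDeriv_mul hf ((hl x).apply hZ)]
      simp only [dirDeriv]
      ring
  · intro X Z x hX hZ
    change L Z x (X x) - L X x (Z x) = _
    refine uniq x _ _ (fun W hW ↦ ?_) ?_
    · rw [← koszul_torsion D.γ_symm, map_sub, _root_.sub_apply,
        key2 X Z W x hX hZ hW, key2 Z X W x hZ hX hW, D.U_symm x (Z x)]
      ring
    · rw [map_sub, key1 X Z x hX hZ, key1 Z X x hZ hX, D.U_symm x (Z x), D.F_antisymm x (Z x)]
      simp only [F, _root_.smul_apply, extDeriv_apply (hl x) hX hZ, smul_eq_mul]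
      ring
  · intro X Z W x hX hZ hW
    change _ - D.γ x (L Z x (X x)) (W x) - D.γ x (Z x) (L W x (X x)) = _
    rw [D.γ_symm x (Z x), ← koszul_metric D.γ_symm, key2 X Z W x hX hZ hW, key2 X W Z x hX hW hZ]
    ring
  · intro X Z x hX hZ
    change _ - D.ell x (L Z x (X x)) = _
    rw [key1 X Z x hX hZ]
    ring

/-- The metric hypersurface connection `∇°` of null metric hypersurface data. -/
noncomputable def nablao : Connection E M := D.exists_metricHypersurfaceConnection.choose

theorem isMetricHypersurfaceConnection : D.IsMetricHypersurfaceConnection D.nablao :=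
  D.exists_metricHypersurfaceConnection.choose_spec

end NullMetricData

/-! ## Abstract Killing horizons -/

namespace NullHypersurfaceData

variable (D : NullHypersurfaceData E M)

/-- `r = Y(n, ·)`. -/
noncomputable def r : Covector E M := fun x ↦ D.Y x (D.n x)

/-- The data `D` is an abstract Killing horizon of order zero with symmetry generator `ηbar`: a
smooth vector field in the radical of `γ`, the zero set of which has empty interior, and such that
`£_ηbar γ = 0`. -/
structure IsAKH0 (ηbar : VField E M) : Prop where
  smooth : ηbar.SmoothOn Set.univ
  radical : ∀ x v, D.γ x (ηbar x) v = 0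
  interior_zeros : interior {x | ηbar x = 0} = ∅
  lie_γ : ∀ x, lieDeriv ηbar D.γ x = 0

/-- The tensor
`∇°_a ∇°_b α + 2 (∇°_(a α) (s_b) - r_b)) + 2 α ∇°_(a s_b) + n(α) Y_ab - α £_n Y_ab`
(round brackets denote symmetrization), evaluated on two vectors `v`, `w`. -/
noncomputable def orderOneTensor (α : M → ℝ) (x : M) (v w : TangentSpace 𝓘(ℝ, E) x) : ℝ :=
  covDeriv D.nablao (differential α) x v w
    + (differential α x v * (D.s x w - D.r x w) + differential α x w * (D.s x v - D.r x v))
    + α x * (covDeriv D.nablao D.s x v w + covDeriv D.nablao D.s x w v)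
    + dirDeriv D.n α x * D.Y x v w
    - α x * lieDeriv D.n D.Y x v w

/-- The data `D` is an abstract Killing horizon of order one with symmetry generator
`ηbar = α n`. -/
structure IsAKH1 (ηbar : VField E M) : Prop extends D.IsAKH0 ηbar where
  order_one : ∃ α : M → ℝ, ContMDiff 𝓘(ℝ, E) 𝓘(ℝ, ℝ) ∞ α ∧ (∀ x, ηbar x = α x • D.n x) ∧
    ∀ x v w, D.orderOneTensor α x v w = 0

end NullHypersurfaceData

end Calculus

/-! ## Embedded data -/

section Embedded

variable {E : Type*} [NormedAddCommGroup E] [NormedSpace ℝ E]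
  {N : Type*} [TopologicalSpace N] [ChartedSpace E N]
  {E' : Type*} [NormedAddCommGroup E'] [NormedSpace ℝ E']
  {M : Type*} [TopologicalSpace M] [ChartedSpace E' M]

/-- The push-forward `φ_⋆ v` of a tangent vector. -/
noncomputable def push (E E' : Type*) [NormedAddCommGroup E] [NormedSpace ℝ E]
    [NormedAddCommGroup E'] [NormedSpace ℝ E'] {N M : Type*} [TopologicalSpace N]
    [ChartedSpace E N] [TopologicalSpace M] [ChartedSpace E' M] (φ : N → M) (p : N) :
    TangentSpace 𝓘(ℝ, E) p →L[ℝ] TangentSpace 𝓘(ℝ, E') (φ p) :=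
  mfderiv 𝓘(ℝ, E) 𝓘(ℝ, E') φ p

variable [IsManifold 𝓘(ℝ, E) ∞ N] [IsManifold 𝓘(ℝ, E') ∞ M]

/-- The vector field `V` of `M`, smooth on an open neighbourhood of `φ(N)`, is an extension off
`φ(N)` of the vector field `v` along `φ(N)`. The values of `V` away from the neighbourhood are
irrelevant. -/
def IsExtension (φ : N → M) (v : Π p : N, TangentSpace 𝓘(ℝ, E') (φ p)) (V : VField E' M) : Prop :=
  ∃ O : Set M, IsOpen O ∧ Set.range φ ⊆ O ∧ V.SmoothOn O ∧ ∀ p, V (φ p) = v p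

variable [FiniteDimensional ℝ E] [FiniteDimensional ℝ E']

/-- The null hypersurface data `D` is `{φ, ζ}`-embedded in the spacetime `(M, g)`. The pull-back of
`£_ζ g` does not depend on the extension of `ζ` off `φ(N)` used to compute it. -/
structure IsEmbedded (D : NullHypersurfaceData E N) (G : LorentzMetric E' M) (φ : N → M)
    (ζ : Π p : N, TangentSpace 𝓘(ℝ, E') (φ p)) : Prop where
  dim : Module.finrank ℝ E' = Module.finrank ℝ E + 1
  embedding : Manifold.IsSmoothEmbedding 𝓘(ℝ, E) 𝓘(ℝ, E') ∞ φ
  rigging_smooth : ContMDiff 𝓘(ℝ, E) (𝓘(ℝ, E').prod 𝓘(ℝ, E')) ∞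
    (fun p ↦ (⟨φ p, ζ p⟩ : TangentBundle 𝓘(ℝ, E') M))
  transverse : ∀ p v, push E E' φ p v ≠ ζ p
  pull_γ : ∀ p v w, G.g (φ p) (push E E' φ p v) (push E E' φ p w) = D.γ p v w
  pull_ell : ∀ p v, G.g (φ p) (ζ p) (push E E' φ p v) = D.ell p v
  pull_ell2 : ∀ p, G.g (φ p) (ζ p) (ζ p) = D.ell2 p
  pull_Y : ∃ ζx : VField E' M, IsExtension φ ζ ζx ∧ ∀ p v w,
    (1 / 2) * lieDeriv ζx G.g (φ p) (push E E' φ p v) (push E E' φ p w) = D.Y p v w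

/-- The deformation tensor `K = £_η g`. -/
noncomputable def deformation (G : LorentzMetric E' M) (η : VField E' M) : Tensor2 E' M :=
  lieDeriv η G.g

/-- `𝔭 = φ^⋆(K(ζ, ζ))`. -/
noncomputable def pFun (G : LorentzMetric E' M) (η : VField E' M) (φ : N → M)
    (ζ : Π p : N, TangentSpace 𝓘(ℝ, E') (φ p)) (p : N) : ℝ :=
  deformation G η (φ p) (ζ p) (ζ p)

/-- `𝔴 = φ^⋆(K(ζ, ν))`, where `ν = φ_⋆ n` is the null normal with `g(ζ, ν) = 1`. -/
noncomputable def wFun (D : NullHypersurfaceData E N) (G : LorentzMetric E' M) (η : VField E' M)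
    (φ : N → M) (ζ : Π p : N, TangentSpace 𝓘(ℝ, E') (φ p)) (p : N) : ℝ :=
  deformation G η (φ p) (ζ p) (push E E' φ p (D.n p))

/-- `𝔮 = φ^⋆(K(ζ, ·))`. -/
noncomputable def qForm (G : LorentzMetric E' M) (η : VField E' M) (φ : N → M)
    (ζ : Π p : N, TangentSpace 𝓘(ℝ, E') (φ p)) : Covector E N := fun p ↦
  (deformation G η (φ p) (ζ p)) ∘L (push E E' φ p)

/-- `ℑ = ½ φ^⋆(£_ζ K)`, computed with a vector field `ζx` of `M` that extends the rigging. -/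
noncomputable def ITensor (G : LorentzMetric E' M) (η : VField E' M) (φ : N → M)
    (ζx : VField E' M) (p : N) (v w : TangentSpace 𝓘(ℝ, E) p) : ℝ :=
  (1 / 2) * lieDeriv ζx (deformation G η) (φ p) (push E E' φ p v) (push E E' φ p w)

/-- `𝔅_ab = ∇°_(a 𝔮_b) + 𝔴 Y_ab + 𝔭 U_ab - ℑ_ab`, evaluated on two vectors. -/
noncomputable def BTensor (D : NullHypersurfaceData E N) (G : LorentzMetric E' M)
    (η : VField E' M) (φ : N → M) (ζ : Π p : N, TangentSpace 𝓘(ℝ, E') (φ p)) (ζx : VField E' M)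
    (p : N) (v w : TangentSpace 𝓘(ℝ, E) p) : ℝ :=
  (1 / 2) * (covDeriv D.nablao (qForm G η φ ζ) p v w + covDeriv D.nablao (qForm G η φ ζ) p w v)
    + wFun D G η φ ζ p * D.Y p v w + pFun G η φ ζ p * D.U p v w - ITensor G η φ ζx p v w

end Embedded

end NullHyp

/-! Write `a = α n` for the generator and `Σ = £_η ∇`. Since `γ(n, ·) = 0`, one has `£_a γ = α £_n
γ`, so `U` vanishes wherever `α ≠ 0`. That set is dense, hence `U = 0` (`U_eq_zero`): the
hypersurface is totally geodesic. The Gauss formula (`cov_eq_push`) then says that for tangent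
fields `∇_X W` is the push-forward of `∇°_X W - Y(X, W) n`.

As `η` is tangent to the hypersurface too, brackets with `η` are push-forwards of brackets with `a`.
So `Σ(X, W)` is the push-forward of the Lie derivative along `a` of the connection `∇° - Y ⊗ n`, and
`g(Σ(X, W), ζ)` is the `ℓ`-component of that derivative. Its symmetrization is exactly the tensor in
the order-one condition (`ell_tangential_lieConnection_symm`); `Σ` is symmetric because `∇` is
torsion-free, so `g(Σ(X, W), ζ) = 0`.

The other components come from `2 g(Σ(X, W), Z) = (∇_X K)(W, Z) + (∇_W K)(X, Z) - (∇_Z K)(X, W)`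
(`two_mul_lieConnection`). For tangent `Z` the right side vanishes, because `φ^⋆ K = £_a γ = 0` and
`∇` preserves tangency. Tangent vectors and `ζ` span, so `Σ = 0` on tangent vectors. For `Z = ζ` the
same identity reads `g(Σ(X, W), ζ) = 𝔅(X, W)` (`lieConnection_rigging`), so `𝔅 = 0`. If `𝔮 = 0`,
then `𝔴 = 𝔮(n) = 0` and `𝔅` reduces to `-ℑ`. -/

namespace NullHyp

/-! ### Smooth fields at a point, and the bracket as a commutator. -/

section SmoothCalculus

variable {E : Type*} [NormedAddCommGroup E] [NormedSpace ℝ E]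
  {M : Type*} [TopologicalSpace M] [ChartedSpace E M]
  {E' : Type*} [NormedAddCommGroup E'] [NormedSpace ℝ E']
  {M' : Type*} [TopologicalSpace M'] [ChartedSpace E' M']

/-- Smoothness of a function at a point. -/
abbrev SmoothFnAt (E : Type*) [NormedAddCommGroup E] [NormedSpace ℝ E]
    {M : Type*} [TopologicalSpace M] [ChartedSpace E M] (f : M → ℝ) (x : M) : Prop :=
  ContMDiffAt 𝓘(ℝ, E) 𝓘(ℝ, ℝ) ∞ f x

variable [IsManifold 𝓘(ℝ, E) ∞ M] [IsManifold 𝓘(ℝ, E') ∞ M']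

/-- Smoothness of a vector field at a point. -/
def VField.SmoothAt (X : VField E M) (x : M) : Prop :=
  ContMDiffAt 𝓘(ℝ, E) (𝓘(ℝ, E).prod 𝓘(ℝ, E)) ∞
    (fun y ↦ (⟨y, X y⟩ : TangentBundle 𝓘(ℝ, E) M)) x

/-- Smoothness of a covector field at a point. -/
def Covector.SmoothAt (σ : Covector E M) (x : M) : Prop :=
  ContMDiffAt 𝓘(ℝ, E) (𝓘(ℝ, E).prod 𝓘(ℝ, E →L[ℝ] ℝ)) ∞
    (fun y ↦ TotalSpace.mk' (E →L[ℝ] ℝ) y (σ y)) x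

/-- Smoothness of a `(0,2)`-tensor field at a point. -/
def Tensor2.SmoothAt (T : Tensor2 E M) (x : M) : Prop :=
  ContMDiffAt 𝓘(ℝ, E) (𝓘(ℝ, E).prod 𝓘(ℝ, E →L[ℝ] E →L[ℝ] ℝ)) ∞
    (fun y ↦ TotalSpace.mk' (E →L[ℝ] E →L[ℝ] ℝ) y (T y)) x

theorem VField.SmoothAt.diffAt {X : VField E M} {x : M} (h : X.SmoothAt x) : X.DiffAt x :=
  ContMDiffAt.mdifferentiableAt h (by simp)

theorem Covector.SmoothAt.diffAt {σ : Covector E M} {x : M} (h : σ.SmoothAt x) : σ.DiffAt x :=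
  ContMDiffAt.mdifferentiableAt h (by simp)

theorem Tensor2.SmoothAt.diffAt {T : Tensor2 E M} {x : M} (h : T.SmoothAt x) : T.DiffAt x :=
  ContMDiffAt.mdifferentiableAt h (by simp)

theorem SmoothFnAt.diffAt {f : M → ℝ} {x : M} (h : SmoothFnAt E f x) :
    MDifferentiableAt 𝓘(ℝ, E) 𝓘(ℝ, ℝ) f x :=
  ContMDiffAt.mdifferentiableAt h (by simp)

theorem VField.SmoothOn.smoothAt {X : VField E M} {s : Set M} (h : X.SmoothOn s)
    (hs : IsOpen s) {x : M} (hx : x ∈ s) : X.SmoothAt x :=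
  ContMDiffOn.contMDiffAt h (hs.mem_nhds hx)

/-- The formulas for brackets and tensors hold at points where the fields are differentiable. To
differentiate such a formula once more at `x`, it must hold near `x`. -/
theorem VField.SmoothAt.eventually_diffAt {X : VField E M} {x : M} (h : X.SmoothAt x) :
    ∀ᶠ y in 𝓝 x, X.DiffAt y := by
  -- Smoothness of order `∞` at a point gives, for each finite order, a neighbourhood depending on
  -- that order. Order `1` is enough here.
  have h1 : ContMDiffAt 𝓘(ℝ, E) (𝓘(ℝ, E).prod 𝓘(ℝ, E)) 1
    (fun y ↦ (⟨y, X y⟩ : TangentBundle 𝓘(ℝ, E) M)) x := ContMDiffAt.of_le h (by simp)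
  filter_upwards [(contMDiffAt_iff_contMDiffAt_nhds (by simp)).1 h1] with y hy
  exact ContMDiffAt.mdifferentiableAt hy (by simp)

theorem VField.SmoothAt.add {X Y : VField E M} {x : M} (hX : X.SmoothAt x) (hY : Y.SmoothAt x) :
    VField.SmoothAt (X + Y) x :=
  ContMDiffAt.add_section hX hY

theorem VField.SmoothAt.sub {X Y : VField E M} {x : M} (hX : X.SmoothAt x) (hY : Y.SmoothAt x) :
    VField.SmoothAt (X - Y) x :=
  ContMDiffAt.sub_section hX hY

theorem VField.SmoothAt.smul {f : M → ℝ} {X : VField E M} {x : M} (hf : SmoothFnAt E f x)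
    (hX : X.SmoothAt x) : VField.SmoothAt (f • X) x :=
  ContMDiffAt.smul_section hf hX

theorem Tensor2.SmoothAt.apply {T : Tensor2 E M} {x : M} (hT : T.SmoothAt x) {V W : VField E M}
    (hV : V.SmoothAt x) (hW : W.SmoothAt x) : SmoothFnAt E (fun y ↦ T y (V y) (W y)) x := by
  have := ContMDiffAt.clm_bundle_apply₂ (F₃ := ℝ) (E₃ := Bundle.Trivial M ℝ) (b := fun y => y)
    (ψ := T) (v := V) (w := W) hT hV hW
  rw [contMDiffAt_totalSpace] at this
  exact this.2

theorem Covector.SmoothAt.apply {σ : Covector E M} {x : M} (hσ : σ.SmoothAt x) {V : VField E M}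
    (hV : V.SmoothAt x) : SmoothFnAt E (fun y ↦ σ y (V y)) x := by
  have := ContMDiffAt.clm_bundle_apply (F₂ := ℝ) (E₂ := Bundle.Trivial M ℝ) (b := fun y => y)
    (ϕ := σ) (v := V) hσ hV
  rw [contMDiffAt_totalSpace] at this
  exact this.2

theorem exists_smooth_field {x : M} (v : TangentSpace 𝓘(ℝ, E) x) :
    ∃ V : VField E M, V.SmoothAt x ∧ V x = v :=
  ⟨FiberBundle.extend E v, FiberBundle.contMDiffAt_extend .., by simp⟩

/-- Serves both for push-forwards along the embedding and, with target `ℝ`, for the functions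
`X(f)`. -/
theorem smoothAt_mfderiv_apply {f : M → M'} {X : VField E M} {x : M}
    (hf : ContMDiffAt 𝓘(ℝ, E) 𝓘(ℝ, E') ∞ f x) (hX : X.SmoothAt x) :
    ContMDiffAt 𝓘(ℝ, E) (𝓘(ℝ, E').prod 𝓘(ℝ, E')) ∞
      (fun y ↦ (⟨f y, mfderiv 𝓘(ℝ, E) 𝓘(ℝ, E') f y (X y)⟩ : TangentBundle 𝓘(ℝ, E') M')) x := by
  have h1 := hf.mfderiv_const (m := ∞) (by simp)
  exact ContMDiffAt.clm_apply_of_inCoordinates (b₁ := id) (b₂ := f) h1 hX hf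

theorem SmoothFnAt.dirDeriv {f : M → ℝ} {X : VField E M} {x : M}
    (hX : X.SmoothAt x) (hf : SmoothFnAt E f x) : SmoothFnAt E (dirDeriv X f) x := by
  have h := smoothAt_mfderiv_apply hf hX
  rw [contMDiffAt_totalSpace] at h
  exact h.2.congr_of_eventuallyEq (Filter.Eventually.of_forall fun y ↦ by
    simp [NullHyp.dirDeriv]
    rfl)

variable [FiniteDimensional ℝ E] [FiniteDimensional ℝ E']

theorem VField.SmoothAt.lieBr {X Y : VField E M} {x : M} (hX : X.SmoothAt x) (hY : Y.SmoothAt x) :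
    VField.SmoothAt (lieBr X Y) x := by
  have : IsManifold 𝓘(ℝ, E) (minSmoothness ℝ 2) M := by
    simpa using (inferInstance : IsManifold 𝓘(ℝ, E) 2 M)
  have : IsManifold 𝓘(ℝ, E) ((⊤ : ℕ∞) + 1 : WithTop ℕ∞) M := by simpa
  exact ContMDiffAt.mlieBracket_vectorField (m := ⊤) (n := ⊤) hX hY (by simp)

theorem dirDeriv_congr {X : VField E M} {f g : M → ℝ} {x : M} (h : f =ᶠ[𝓝 x] g) :
    dirDeriv X f x = dirDeriv X g x := by
  exact congrArg (fun L : E →L[ℝ] ℝ ↦ L (X x)) h.mfderiv_eq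

theorem dirDeriv_sub {f g : M → ℝ} {Z : VField E M} {x : M}
    (hf : MDifferentiableAt 𝓘(ℝ, E) 𝓘(ℝ, ℝ) f x) (hg : MDifferentiableAt 𝓘(ℝ, E) 𝓘(ℝ, ℝ) g x) :
    dirDeriv Z (fun y => f y - g y) x = dirDeriv Z f x - dirDeriv Z g x := by
  have := mvfderiv_sub hf hg
  simp only [dirDeriv]
  erw [this]
  rfl

theorem leibniz_lieBr {X Y Z : VField E M} {x : M} (hX : X.SmoothAt x) (hY : Y.SmoothAt x)
    (hZ : Z.SmoothAt x) :
    lieBr X (lieBr Y Z) x = lieBr (lieBr X Y) Z x + lieBr Y (lieBr X Z) x := by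
  have : IsManifold 𝓘(ℝ, E) (minSmoothness ℝ 3) M := by
    simpa using (inferInstance : IsManifold 𝓘(ℝ, E) 3 M)
  have h2 : minSmoothness ℝ 2 ≤ ∞ := by
    rw [minSmoothness_of_isRCLikeNormedField]
    exact WithTop.coe_le_coe.2 le_top
  exact leibniz_identity_mlieBracket_apply (ContMDiffAt.of_le hX h2)
    (ContMDiffAt.of_le hY h2) (ContMDiffAt.of_le hZ h2)

/-- In finite dimension a linear map is a finite sum of coordinate functionals times its values on a
basis. -/
theorem contMDiffAt_clm_of_apply {F : Type*} [NormedAddCommGroup F] [NormedSpace ℝ F]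
    {f : M → E' →L[ℝ] F} {x : M}
    (h : ∀ v, ContMDiffAt 𝓘(ℝ, E) 𝓘(ℝ, F) ∞ (fun y ↦ f y v) x) :
    ContMDiffAt 𝓘(ℝ, E) 𝓘(ℝ, E' →L[ℝ] F) ∞ f x := by
  let b := Module.finBasis ℝ E'
  let c : Fin (Module.finrank ℝ E') → E' →L[ℝ] ℝ := fun i ↦
    LinearMap.toContinuousLinearMap (b.coord i)
  have : f = fun y ↦ ∑ i, ContinuousLinearMap.smulRightL ℝ E' F (c i) (f y (b i)) := by
    ext y v
    conv_lhs => rw [← b.sum_repr v, map_sum]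
    simp [c]
  rw [this]
  refine contMDiffAt_finsetSum fun i _ ↦ ?_
  exact (ContinuousLinearMap.contMDiff _).contMDiffAt.comp x (h (b i))

/-- Fields with constant components in the trivialization at `x`; evaluating a tensor on them reads
off its components. -/
theorem smoothAt_trivialization_symm (x : M) (v : E) :
    VField.SmoothAt (fun y ↦ (trivializationAt E (TangentSpace 𝓘(ℝ, E)) x).symm y v) x := by
  set e := trivializationAt E (TangentSpace 𝓘(ℝ, E) : M → Type _) x with he
  have hx : x ∈ e.baseSet := FiberBundle.mem_baseSet_trivializationAt' x
  have h1 : VField.SmoothAt (FiberBundle.extend E (e.symm x v)) x :=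
    FiberBundle.contMDiffAt_extend ..
  convert h1 using 2 with y
  rw [FiberBundle.extend, e.apply_mk_symm hx]

theorem Covector.smoothAt_of_apply {σ : Covector E M} {x : M}
    (h : ∀ V : VField E M, V.SmoothAt x → SmoothFnAt E (fun y ↦ σ y (V y)) x) :
    σ.SmoothAt x := by
  set e := trivializationAt E (TangentSpace 𝓘(ℝ, E) : M → Type _) x with he
  have hx : e.baseSet ∈ 𝓝 x :=
    e.open_baseSet.mem_nhds (FiberBundle.mem_baseSet_trivializationAt' x)
  refine (contMDiffAt_hom_bundle _).2 ⟨contMDiffAt_id, ?_⟩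
  refine contMDiffAt_clm_of_apply fun v ↦ ?_
  refine (h _ (smoothAt_trivialization_symm x v)).congr_of_eventuallyEq ?_
  filter_upwards [hx] with y hy
  rw [ContinuousLinearMap.inCoordinates_eq hy (by simp)]
  rfl

theorem Tensor2.smoothAt_of_apply {T : Tensor2 E M} {x : M}
    (h : ∀ V W : VField E M, V.SmoothAt x → W.SmoothAt x →
      SmoothFnAt E (fun y ↦ T y (V y) (W y)) x) :
    T.SmoothAt x := by
  set e := trivializationAt E (TangentSpace 𝓘(ℝ, E) : M → Type _) x with he
  have hx : e.baseSet ∈ 𝓝 x :=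
    e.open_baseSet.mem_nhds (FiberBundle.mem_baseSet_trivializationAt' x)
  refine (contMDiffAt_hom_bundle _).2 ⟨contMDiffAt_id, ?_⟩
  refine contMDiffAt_clm_of_apply fun v ↦ contMDiffAt_clm_of_apply fun w ↦ ?_
  refine (h _ _ (smoothAt_trivialization_symm x v)
    (smoothAt_trivialization_symm x w)).congr_of_eventuallyEq ?_
  filter_upwards [hx] with y hy
  have := inCoordinates_apply_eq₂ (ϕ := T y) (v := v) (w := w) (x₀ := x) (𝕜 := ℝ) (F₁ := E)
    (F₂ := E) (F₃ := ℝ) (E₁ := TangentSpace 𝓘(ℝ, E)) (E₂ := TangentSpace 𝓘(ℝ, E))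
    (E₃ := Bundle.Trivial M ℝ) hy hy (by simp)
  simpa using this

/-- A vector field `V` is smooth if the covector field `B(V, ·)` is, where `B` is smooth and
nondegenerate. -/
theorem VField.smoothAt_of_tensor2_apply {B : Tensor2 E M} {x : M} (hB : B.SmoothAt x)
    (hinj : ∀ y v, B y v = 0 → v = 0) {V : VField E M}
    (h : ∀ W : VField E M, W.SmoothAt x → SmoothFnAt E (fun y ↦ B y (V y) (W y)) x) :
    V.SmoothAt x := by
  set e := trivializationAt E (TangentSpace 𝓘(ℝ, E) : M → Type _) x with he
  have hx0 : x ∈ e.baseSet := FiberBundle.mem_baseSet_trivializationAt' x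
  have hx : e.baseSet ∈ 𝓝 x := e.open_baseSet.mem_nhds hx0
  -- In the trivialization at `x`, `Bc` represents `B` and `lc` represents the covector `B(V, ·)`.
  -- The components of `V` are `Bc⁻¹ lc`, and inversion of linear maps is smooth at invertible ones.
  let Bc : M → E →L[ℝ] E →L[ℝ] ℝ := fun y ↦ ContinuousLinearMap.inCoordinates E
    (TangentSpace 𝓘(ℝ, E)) (E →L[ℝ] ℝ) (fun y : M ↦ TangentSpace 𝓘(ℝ, E) y →L[ℝ] ℝ) x y x y (B y)
  have hBc : ∀ y ∈ e.baseSet, ∀ v w, Bc y v w = B y (e.symm y v) (e.symm y w) := by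
    intro y hy v w
    have := inCoordinates_apply_eq₂ (ϕ := B y) (v := v) (w := w) (x₀ := x) (𝕜 := ℝ) (F₁ := E)
      (F₂ := E) (F₃ := ℝ) (E₁ := TangentSpace 𝓘(ℝ, E)) (E₂ := TangentSpace 𝓘(ℝ, E))
      (E₃ := Bundle.Trivial M ℝ) hy hy (by simp)
    simpa using this
  have hBs : ContMDiffAt 𝓘(ℝ, E) 𝓘(ℝ, E →L[ℝ] E →L[ℝ] ℝ) ∞ Bc x :=
    ((contMDiffAt_hom_bundle _).1 hB).2
  let lc : M → E →L[ℝ] ℝ := fun y ↦ (B y (V y)).comp (e.symmL ℝ y)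
  have hlc : ∀ y ∈ e.baseSet, ∀ w, lc y w = B y (V y) (e.symm y w) := fun y hy w ↦ by
    rw [← Trivialization.symmL_apply (R := ℝ) e hy w]
    rfl
  have hls : ContMDiffAt 𝓘(ℝ, E) 𝓘(ℝ, E →L[ℝ] ℝ) ∞ lc x :=
    contMDiffAt_clm_of_apply fun w ↦
      (h _ (smoothAt_trivialization_symm x w)).congr_of_eventuallyEq
        (by filter_upwards [hx] with y hy using hlc y hy w)
  have hinv : ∀ y ∈ e.baseSet, (Bc y).IsInvertible := by
    intro y hy
    refine invertible_of_injective fun v hv ↦ ?_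
    have h3 : e.symm y v = 0 := by
      refine hinj y _ ?_
      ext w
      have := congrArg (fun f ↦ f (e.continuousLinearMapAt ℝ y w)) hv
      simp only [hBc y hy] at this
      rw [← Trivialization.symmL_apply (R := ℝ) e hy (e.continuousLinearMapAt ℝ y w),
        e.symmL_continuousLinearMapAt hy] at this
      exact this
    rw [← e.continuousLinearMapAt_symmL (R := ℝ) hy v, Trivialization.symmL_apply, h3, map_zero]
    exact hy
  have hN : ContMDiffAt 𝓘(ℝ, E) 𝓘(ℝ, E) ∞ (fun y ↦ (Bc y).inverse (lc y)) x := by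
    have h1 : ContDiffAt ℝ ∞ (ContinuousLinearMap.inverse : (E →L[ℝ] E →L[ℝ] ℝ) → _) (Bc x) :=
      (hinv x hx0).contDiffAt_map_inverse
    have h2 : ContMDiffAt 𝓘(ℝ, E) 𝓘(ℝ, (E →L[ℝ] ℝ) →L[ℝ] E) ∞ (fun y ↦ (Bc y).inverse) x :=
      h1.contMDiffAt.comp x hBs
    exact h2.clm_apply hls
  refine (contMDiffAt_section _).2 (hN.congr_of_eventuallyEq ?_)
  filter_upwards [hx] with y hy
  symm
  rw [(hinv y hy).inverse_apply_eq]
  ext w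
  rw [hBc y hy, e.symm_apply_apply_mk hy, hlc y hy]

/-- The Lie bracket of vector fields is the commutator of derivations. -/
theorem dirDeriv_lieBr {X Y : VField E M} {f : M → ℝ} {x : M} (hX : X.SmoothAt x)
    (hY : Y.SmoothAt x) (hf : SmoothFnAt E f x) :
    dirDeriv (lieBr X Y) f x = dirDeriv X (dirDeriv Y f) x - dirDeriv Y (dirDeriv X f) x := by
  -- The identity is extracted from the coefficient of a nonzero vector `W x`. If the tangent space
  -- is zero, both sides vanish.
  by_cases hE : ∃ w : TangentSpace 𝓘(ℝ, E) x, w ≠ 0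
  swap
  · push Not at hE
    have h0 : ∀ (Z : VField E M) (g : M → ℝ), dirDeriv Z g x = 0 := fun Z g ↦ by
      rw [dirDeriv, hE (Z x), map_zero]
    simp [h0]
  obtain ⟨w, hw⟩ := hE
  obtain ⟨W, hW, rfl⟩ := exists_smooth_field w
  have aux : ∀ {Z : VField E M}, Z.SmoothAt x →
      lieBr Z (f • W) =ᶠ[𝓝 x] dirDeriv Z f • W + f • lieBr Z W := by
    intro Z hZ
    have hf1 : ∀ᶠ y in 𝓝 x, MDifferentiableAt 𝓘(ℝ, E) 𝓘(ℝ, ℝ) f y := by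
      have h1 : ContMDiffAt 𝓘(ℝ, E) 𝓘(ℝ, ℝ) 1 f x := ContMDiffAt.of_le hf (by simp)
      filter_upwards [(contMDiffAt_iff_contMDiffAt_nhds (by simp)).1 h1] with y hy
      exact hy.mdifferentiableAt (by simp)
    filter_upwards [hf1, hW.eventually_diffAt] with y hy hy'
    exact lieBr_smul_right hy hy'
  have second : ∀ {Z Z' : VField E M}, Z.SmoothAt x → Z'.SmoothAt x →
      lieBr Z (lieBr Z' (f • W)) x = dirDeriv Z (dirDeriv Z' f) x • W x
        + dirDeriv Z' f x • lieBr Z W x + dirDeriv Z f x • lieBr Z' W x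
        + f x • lieBr Z (lieBr Z' W) x := by
    intro Z Z' hZ hZ'
    have h1 : lieBr Z (lieBr Z' (f • W)) x = lieBr Z (dirDeriv Z' f • W + f • lieBr Z' W) x :=
      Filter.EventuallyEq.mlieBracket_vectorField_eq (Filter.EventuallyEq.refl _ Z) (aux hZ')
    have hZf := hf.dirDeriv hZ'
    have hZW := hZ'.lieBr hW
    rw [h1, lieBr_add_right (hZf.diffAt |> fun h ↦ VField.DiffAt.smul h hW.diffAt)
      (VField.DiffAt.smul hf.diffAt hZW.diffAt), lieBr_smul_right hZf.diffAt hW.diffAt,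
      lieBr_smul_right hf.diffAt hZW.diffAt]
    abel
  -- Jacobi identity applied to `f W`. The terms with one derivative of `f` are symmetric in `X`,
  -- `Y` and cancel, and the terms with none cancel by Jacobi for `W`. What remains is the claim
  -- times `W x`.
  have key := leibniz_lieBr hX hY (VField.SmoothAt.smul hf hW)
  rw [second hX hY, second hY hX, lieBr_smul_right hf.diffAt hW.diffAt, leibniz_lieBr hX hY hW]
    at key
  have : (dirDeriv (lieBr X Y) f x - (dirDeriv X (dirDeriv Y f) x - dirDeriv Y (dirDeriv X f) x))
      • W x = 0 := by
    rw [sub_smul, sub_smul]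
    rw [smul_add] at key
    linear_combination (norm := module) -key
  exact sub_eq_zero.1 ((smul_eq_zero.1 this).resolve_right hw)

end SmoothCalculus

/-! ### Lie derivatives of tensors, Koszul formula, covariant derivatives of `(0,2)`-tensors. -/

section ConnectionCalculus

variable {E : Type*} [NormedAddCommGroup E] [NormedSpace ℝ E] [FiniteDimensional ℝ E]
  {M : Type*} [TopologicalSpace M] [ChartedSpace E M] [IsManifold 𝓘(ℝ, E) ∞ M]

theorem dirDeriv_const (X : VField E M) (c : ℝ) (x : M) : dirDeriv X (fun _ ↦ c) x = 0 := by
  simp [dirDeriv, mvfderiv_const]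

theorem dirDeriv_const_mul {X : VField E M} {f : M → ℝ} {x : M}
    (hf : MDifferentiableAt 𝓘(ℝ, E) 𝓘(ℝ, ℝ) f x) (c : ℝ) :
    dirDeriv X (fun y ↦ c * f y) x = c * dirDeriv X f x := by
  rw [dirDeriv_mul mdifferentiableAt_const hf, dirDeriv_const]
  ring

theorem SmoothFnAt.eventually_diffAt {f : M → ℝ} {x : M} (h : SmoothFnAt E f x) :
    ∀ᶠ y in 𝓝 x, MDifferentiableAt 𝓘(ℝ, E) 𝓘(ℝ, ℝ) f y := by
  have h1 : ContMDiffAt 𝓘(ℝ, E) 𝓘(ℝ, ℝ) 1 f x := ContMDiffAt.of_le h (by simp)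
  filter_upwards [(contMDiffAt_iff_contMDiffAt_nhds (by simp)).1 h1] with y hy
  exact hy.mdifferentiableAt (by simp)

theorem Tensor2.Smooth.smoothAt {T : Tensor2 E M} (h : T.Smooth) (x : M) : T.SmoothAt x := h x

theorem Covector.Smooth.smoothAt {σ : Covector E M} (h : σ.Smooth) (x : M) : σ.SmoothAt x := h x

theorem lieBr_congr_right {X Y Z : VField E M} {x : M} (h : Y =ᶠ[𝓝 x] Z) :
    lieBr X Y x = lieBr X Z x :=
  Filter.EventuallyEq.mlieBracket_vectorField_eq (Filter.EventuallyEq.refl _ X) h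

/-- `T` is smooth everywhere because the explicit formula for the Lie derivative is used at all
points near `x`. -/
theorem Tensor2.SmoothAt.lieDeriv {T : Tensor2 E M} (hT : T.Smooth) {X : VField E M} {x : M}
    (hX : X.SmoothAt x) : (lieDeriv X T).SmoothAt x := by
  refine Tensor2.smoothAt_of_apply fun V W hV hW ↦ ?_
  have h1 := ((SmoothFnAt.dirDeriv hX ((hT.smoothAt x).apply hV hW)).sub
    ((hT.smoothAt x).apply (hX.lieBr hV) hW)).sub ((hT.smoothAt x).apply hV (hX.lieBr hW))
  refine h1.congr_of_eventuallyEq ?_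
  filter_upwards [hV.eventually_diffAt, hW.eventually_diffAt] with y hVy hWy
  exact lieDeriv_apply (hT.diffAt y) hVy hWy

theorem Covector.Smooth.extDeriv {σ : Covector E M} (hσ : σ.Smooth) : (extDeriv σ).Smooth := by
  intro x
  refine Tensor2.smoothAt_of_apply fun V W hV hW ↦ ?_
  have h1 := ((SmoothFnAt.dirDeriv hV ((hσ.smoothAt x).apply hW)).sub
    (SmoothFnAt.dirDeriv hW ((hσ.smoothAt x).apply hV))).sub
    ((hσ.smoothAt x).apply (hV.lieBr hW))
  refine h1.congr_of_eventuallyEq ?_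
  filter_upwards [hV.eventually_diffAt, hW.eventually_diffAt] with y hVy hWy
  exact extDeriv_apply (hσ.diffAt y) hVy hWy

theorem lieDeriv_symm {T : Tensor2 E M} (hs : ∀ y v w, T y v w = T y w v) {X : VField E M} {x : M}
    (hT : T.DiffAt x) (v w : TangentSpace 𝓘(ℝ, E) x) :
    lieDeriv X T x v w = lieDeriv X T x w v := by
  obtain ⟨V, hV, rfl⟩ := exists_field v
  obtain ⟨W, hW, rfl⟩ := exists_field w
  simp only [lieDeriv_apply hT hV hW, lieDeriv_apply hT hW hV, hs _ (V _),
    hs _ (W x) (lieBr _ _ _)]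
  ring

theorem SmoothFnAt.koszul {T : Tensor2 E M} {Z X W : VField E M} {x : M} (hT : T.SmoothAt x)
    (hZ : Z.SmoothAt x) (hX : X.SmoothAt x) (hW : W.SmoothAt x) :
    SmoothFnAt E (koszul T Z X W) x :=
  contMDiffAt_const.mul ((((((SmoothFnAt.dirDeriv hX (hT.apply hZ hW)).add
    (SmoothFnAt.dirDeriv hZ (hT.apply hW hX))).sub (SmoothFnAt.dirDeriv hW (hT.apply hX hZ))).add
    (hT.apply (hX.lieBr hZ) hW)).sub (hT.apply (hZ.lieBr hW) hX)).add (hT.apply (hW.lieBr hX) hZ))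

/-- The covariant derivative `∇_X Z` as a vector field. -/
noncomputable def cov (nab : Connection E M) (X Z : VField E M) : VField E M :=
  fun x ↦ nab Z x (X x)

/-- A torsion-free connection that preserves a symmetric tensor obeys the Koszul formula. -/
theorem apply_cov_eq_koszul {nab : Connection E M} {T : Tensor2 E M} {x : M}
    (hs : ∀ y v w, T y v w = T y w v)
    (htf : ∀ X Z : VField E M, X.DiffAt x → Z.DiffAt x →
      nab Z x (X x) - nab X x (Z x) = lieBr X Z x)
    (hmet : ∀ X Z W : VField E M, X.DiffAt x → Z.DiffAt x → W.DiffAt x →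
      dirDeriv X (fun y ↦ T y (Z y) (W y)) x
        - T x (nab Z x (X x)) (W x) - T x (Z x) (nab W x (X x)) = 0)
    {X Z W : VField E M} (hX : X.DiffAt x) (hZ : Z.DiffAt x) (hW : W.DiffAt x) :
    T x (cov nab X Z x) (W x) = koszul T Z X W x := by
  -- Compatibility for the three cyclic permutations, combined with signs `+, +, -`; absence of
  -- torsion turns the brackets into differences of covariant derivatives.
  have h1 := hmet X Z W hX hZ hW
  have h2 := hmet Z W X hZ hW hX
  have h3 := hmet W X Z hW hX hZ
  rw [koszul, ← htf X Z hX hZ, ← htf Z W hZ hW, ← htf W X hW hX]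
  simp only [map_sub, _root_.sub_apply, cov]
  rw [hs x (Z x)] at h1
  rw [hs x (W x)] at h2
  rw [hs x (X x)] at h3
  linarith

/-- The covariant derivative `(∇_X T)(W, Z)` of a `(0,2)`-tensor field. -/
noncomputable def covDeriv2 (nab : Connection E M) (T : Tensor2 E M) (X W Z : VField E M)
    (x : M) : ℝ :=
  dirDeriv X (fun y ↦ T y (W y) (Z y)) x - T x (cov nab X W x) (Z x) - T x (W x) (cov nab X Z x)

/-- The expression is tensorial in `W` and `Z`, and `X` enters only through its value at `x`. -/
theorem covDeriv2_congr {nab : Connection E M} {T : Tensor2 E M} {x : M} (hT : T.DiffAt x)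
    {X W Z X' W' Z' : VField E M} (hX : X x = X' x) (hW : W x = W' x) (hZ : Z x = Z' x)
    (hWd : W.DiffAt x) (hWd' : W'.DiffAt x) (hZd : Z.DiffAt x) (hZd' : Z'.DiffAt x) :
    covDeriv2 nab T X W Z x = covDeriv2 nab T X' W' Z' x := by
  have h0 : covDeriv2 nab T X W Z x = covDeriv2 nab T X' W Z x := by
    simp only [covDeriv2, cov, dirDeriv, hX]
  rw [h0]
  refine TensorialAt.pointwise₂ (I := 𝓘(ℝ, E)) (F := E) (F' := E)
    (Φ := fun W Z ↦ covDeriv2 nab T X' W Z x) ?_ ?_ hWd hWd' hZd hZd' hW hZ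
  · intro Z hZ
    constructor
    · intro f W hf hW
      simp only [covDeriv2, cov, nab.isCovariantDerivativeOn.leibniz hW hf, Pi.smul_apply',
        map_smul, smul_eq_mul, dirDeriv_mul hf (hT.apply hW hZ), map_add, _root_.add_apply,
        _root_.smul_apply, ContinuousLinearMap.smulRight_apply]
      simp only [dirDeriv]
      ring
    · intro W W' hW hW'
      simp only [covDeriv2, cov, nab.isCovariantDerivativeOn.add hW hW', Pi.add_apply,
        dirDeriv_add (hT.apply hW hZ) (hT.apply hW' hZ), map_add, _root_.add_apply]
      ring
  · intro W hW
    constructor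
    · intro f Z hf hZ
      simp only [covDeriv2, cov, nab.isCovariantDerivativeOn.leibniz hZ hf, Pi.smul_apply',
        map_smul, smul_eq_mul, dirDeriv_mul hf (hT.apply hW hZ), map_add, _root_.add_apply,
        _root_.smul_apply, ContinuousLinearMap.smulRight_apply]
      simp only [dirDeriv]
      ring
    · intro Z Z' hZ hZ'
      simp only [covDeriv2, cov, nab.isCovariantDerivativeOn.add hZ hZ', Pi.add_apply,
        dirDeriv_add (hT.apply hW hZ) (hT.apply hW hZ'), map_add, _root_.add_apply]
      ring

end ConnectionCalculus

/-! ### The Lie derivative of the Levi-Civita connection in terms of the deformation tensor. -/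

namespace LorentzMetric

variable {E : Type*} [NormedAddCommGroup E] [NormedSpace ℝ E] [FiniteDimensional ℝ E]
  {M : Type*} [TopologicalSpace M] [ChartedSpace E M] [IsManifold 𝓘(ℝ, E) ∞ M]
  (G : LorentzMetric E M)

theorem cov_sub_cov {X Z : VField E M} {x : M} (hX : X.DiffAt x) (hZ : Z.DiffAt x) :
    cov G.leviCivita X Z x - cov G.leviCivita Z X x = lieBr X Z x :=
  G.isLeviCivita.torsion_free X Z x hX hZ

theorem dirDeriv_metric {X Z W : VField E M} {x : M} (hX : X.DiffAt x) (hZ : Z.DiffAt x)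
    (hW : W.DiffAt x) :
    dirDeriv X (fun y ↦ G.g y (Z y) (W y)) x =
      G.g x (cov G.leviCivita X Z x) (W x) + G.g x (Z x) (cov G.leviCivita X W x) := by
  have := G.isLeviCivita.metric X Z W x hX hZ hW
  simp only [cov]
  linarith

theorem apply_cov {X Z W : VField E M} {x : M} (hX : X.DiffAt x) (hZ : Z.DiffAt x)
    (hW : W.DiffAt x) :
    G.g x (cov G.leviCivita X Z x) (W x) = koszul G.g Z X W x :=
  apply_cov_eq_koszul G.symm (fun X Z ↦ G.isLeviCivita.torsion_free X Z x)
    (fun X Z W ↦ G.isLeviCivita.metric X Z W x) hX hZ hW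

/-- The characterization of the Levi-Civita connection does not mention smoothness. It follows from
the Koszul formula, whose right side is smooth, and nondegeneracy of the metric. -/
theorem smoothAt_cov {X Z : VField E M} {x : M} (hX : X.SmoothAt x) (hZ : Z.SmoothAt x) :
    (cov G.leviCivita X Z).SmoothAt x := by
  refine VField.smoothAt_of_tensor2_apply (G.smooth.smoothAt x) G.inj fun W hW ↦ ?_
  refine (SmoothFnAt.koszul (G.smooth.smoothAt x) hZ hX hW).congr_of_eventuallyEq ?_
  filter_upwards [hX.eventually_diffAt, hZ.eventually_diffAt, hW.eventually_diffAt]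
    with y hXy hZy hWy
  exact G.apply_cov hXy hZy hWy

theorem deformation_apply {η V W : VField E M} {x : M} (hV : V.DiffAt x) (hW : W.DiffAt x) :
    deformation G η x (V x) (W x) = dirDeriv η (fun y ↦ G.g y (V y) (W y)) x
      - G.g x (lieBr η V x) (W x) - G.g x (V x) (lieBr η W x) :=
  lieDeriv_apply (G.smooth.diffAt x) hV hW

theorem deformation_symm (η : VField E M) (x : M) (v w : TangentSpace 𝓘(ℝ, E) x) :
    deformation G η x v w = deformation G η x w v :=
  lieDeriv_symm G.symm (G.smooth.diffAt x) v w

theorem smoothAt_deformation {η : VField E M} {x : M} (hη : η.SmoothAt x) :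
    (deformation G η).SmoothAt x :=
  Tensor2.SmoothAt.lieDeriv G.smooth hη

theorem lieConnection_eq (nab : Connection E M) (η X W : VField E M) (x : M) :
    lieConnection nab η X W x =
      lieBr η (cov nab X W) x - cov nab X (lieBr η W) x - cov nab (lieBr η X) W x :=
  rfl

/-- The Lie derivative of the identity `∇_X W - ∇_W X = [X, W]`: the bracket terms cancel by Jacobi.
-/
theorem lieConnection_symm {η X W : VField E M} {x : M} (hη : η.SmoothAt x) (hX : X.SmoothAt x)
    (hW : W.SmoothAt x) :
    lieConnection G.leviCivita η X W x = lieConnection G.leviCivita η W X x := by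
  have h1 : cov G.leviCivita X W =ᶠ[𝓝 x] lieBr X W + cov G.leviCivita W X := by
    filter_upwards [hX.eventually_diffAt, hW.eventually_diffAt] with y hXy hWy
    rw [Pi.add_apply, ← G.cov_sub_cov hXy hWy, sub_add_cancel]
  have h2 := G.cov_sub_cov hX.diffAt (hη.lieBr hW).diffAt
  have h3 := G.cov_sub_cov (hη.lieBr hX).diffAt hW.diffAt
  have h4 := leibniz_lieBr hη hX hW
  rw [lieConnection_eq, lieConnection_eq, lieBr_congr_right h1,
    lieBr_add_right (hX.lieBr hW).diffAt (G.smoothAt_cov hW hX).diffAt, h4, ← h2, ← h3]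
  abel

/-- The Lie derivative of `∇g = 0` along `η`: commuting `£_η` with `∇` costs `Σ` in each of the two
slots of `g`. -/
theorem lieConnection_add {η X W Z : VField E M} {x : M} (hη : η.SmoothAt x) (hX : X.SmoothAt x)
    (hW : W.SmoothAt x) (hZ : Z.SmoothAt x) :
    G.g x (lieConnection G.leviCivita η X W x) (Z x)
      + G.g x (lieConnection G.leviCivita η X Z x) (W x) =
    covDeriv2 G.leviCivita (deformation G η) X W Z x := by
  have hg := G.smooth.smoothAt x
  have hXW := G.smoothAt_cov hX hW
  have hXZ := G.smoothAt_cov hX hZ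
  have e1 : dirDeriv X (fun y ↦ deformation G η y (W y) (Z y)) x =
      dirDeriv X (dirDeriv η (fun y ↦ G.g y (W y) (Z y))) x
      - dirDeriv X (fun y ↦ G.g y (lieBr η W y) (Z y)) x
      - dirDeriv X (fun y ↦ G.g y (W y) (lieBr η Z y)) x := by
    have ev : (fun y ↦ deformation G η y (W y) (Z y)) =ᶠ[𝓝 x] fun y ↦
        dirDeriv η (fun y ↦ G.g y (W y) (Z y)) y - G.g y (lieBr η W y) (Z y)
          - G.g y (W y) (lieBr η Z y) := by
      filter_upwards [hW.eventually_diffAt, hZ.eventually_diffAt] with y hWy hZy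
      exact G.deformation_apply hWy hZy
    have d1 := SmoothFnAt.dirDeriv hη (hg.apply hW hZ)
    have d2 := hg.apply (hη.lieBr hW) hZ
    have d3 := hg.apply hW (hη.lieBr hZ)
    rw [dirDeriv_congr ev, dirDeriv_sub (SmoothFnAt.diffAt (ContMDiffAt.sub d1 d2)) d3.diffAt,
      dirDeriv_sub d1.diffAt d2.diffAt]
  have e2 : dirDeriv η (dirDeriv X (fun y ↦ G.g y (W y) (Z y))) x =
      dirDeriv η (fun y ↦ G.g y (cov G.leviCivita X W y) (Z y)) x
      + dirDeriv η (fun y ↦ G.g y (W y) (cov G.leviCivita X Z y)) x := by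
    rw [← dirDeriv_add (hg.apply hXW hZ).diffAt (hg.apply hW hXZ).diffAt]
    refine dirDeriv_congr ?_
    filter_upwards [hX.eventually_diffAt, hW.eventually_diffAt, hZ.eventually_diffAt]
      with y hXy hWy hZy
    exact G.dirDeriv_metric hXy hWy hZy
  -- The second derivatives of `g(W, Z)` along `η` and `X` differ by the derivative along `[η, X]`.
  have e3 := dirDeriv_lieBr hη hX (hg.apply hW hZ)
  rw [G.dirDeriv_metric (hη.lieBr hX).diffAt hW.diffAt hZ.diffAt] at e3
  rw [covDeriv2, e1, G.dirDeriv_metric hX.diffAt (hη.lieBr hW).diffAt hZ.diffAt,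
    G.dirDeriv_metric hX.diffAt hW.diffAt (hη.lieBr hZ).diffAt,
    G.deformation_apply hXW.diffAt hZ.diffAt, G.deformation_apply hW.diffAt hXZ.diffAt,
    lieConnection_eq, lieConnection_eq, G.symm x _ (W x)]
  simp only [map_sub, _root_.sub_apply]
  linarith

/-- `2 g((£_η ∇)(X, W), Z) = (∇_X K)(W, Z) + (∇_W K)(X, Z) - (∇_Z K)(X, W)` for `K = £_η g`. -/
theorem two_mul_lieConnection {η X W Z : VField E M} {x : M} (hη : η.SmoothAt x)
    (hX : X.SmoothAt x) (hW : W.SmoothAt x) (hZ : Z.SmoothAt x) :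
    2 * G.g x (lieConnection G.leviCivita η X W x) (Z x) =
      covDeriv2 G.leviCivita (deformation G η) X W Z x
      + covDeriv2 G.leviCivita (deformation G η) W X Z x
      - covDeriv2 G.leviCivita (deformation G η) Z X W x := by
  -- The three instances of `lieConnection_add` are solved for one component by the symmetry of `Σ`,
  -- as for Christoffel symbols.
  rw [← G.lieConnection_add hη hX hW hZ, ← G.lieConnection_add hη hW hX hZ,
    ← G.lieConnection_add hη hZ hX hW, G.lieConnection_symm hη hW hX,
    G.lieConnection_symm hη hZ hX, G.lieConnection_symm hη hZ hW]
  ring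

/-- Tensoriality of `Σ`, inherited from that of `∇K`. It permits replacing arbitrary fields by ones
tangent to the hypersurface. -/
theorem lieConnection_congr {η X W Z X' W' Z' : VField E M} {x : M} (hη : η.SmoothAt x)
    (hX : X.SmoothAt x) (hW : W.SmoothAt x) (hZ : Z.SmoothAt x) (hX' : X'.SmoothAt x)
    (hW' : W'.SmoothAt x) (hZ' : Z'.SmoothAt x) (hXX' : X x = X' x) (hWW' : W x = W' x)
    (hZZ' : Z x = Z' x) :
    G.g x (lieConnection G.leviCivita η X W x) (Z x) =
      G.g x (lieConnection G.leviCivita η X' W' x) (Z' x) := by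
  have hK := (G.smoothAt_deformation hη).diffAt
  have h1 := G.two_mul_lieConnection hη hX hW hZ
  have h2 := G.two_mul_lieConnection hη hX' hW' hZ'
  rw [covDeriv2_congr hK hXX' hWW' hZZ' hW.diffAt hW'.diffAt hZ.diffAt hZ'.diffAt,
    covDeriv2_congr hK hWW' hXX' hZZ' hX.diffAt hX'.diffAt hZ.diffAt hZ'.diffAt,
    covDeriv2_congr hK hZZ' hXX' hWW' hX.diffAt hX'.diffAt hW.diffAt hW'.diffAt] at h1
  linarith

end LorentzMetric

/-! ### Extension off an immersed manifold, and related vector fields. -/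

section Related

variable {E : Type*} [NormedAddCommGroup E] [NormedSpace ℝ E] [FiniteDimensional ℝ E]
  {N : Type*} [TopologicalSpace N] [ChartedSpace E N] [IsManifold 𝓘(ℝ, E) ∞ N]
  {E' : Type*} [NormedAddCommGroup E'] [NormedSpace ℝ E'] [FiniteDimensional ℝ E']
  {M : Type*} [TopologicalSpace M] [ChartedSpace E' M] [IsManifold 𝓘(ℝ, E') ∞ M]
  {φ : N → M}

/-- In adapted charts an immersion is `u ↦ (u, 0)`; dropping the second factor gives a local left
inverse. -/
theorem exists_local_retraction {p : N}
    (hφ : Manifold.IsImmersionAt 𝓘(ℝ, E) 𝓘(ℝ, E') ∞ φ p) :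
    ∃ ρ : M → N, (∀ᶠ m in 𝓝 (φ p), ContMDiffAt 𝓘(ℝ, E') 𝓘(ℝ, E) ∞ ρ m) ∧
      ∀ᶠ q in 𝓝 p, ρ (φ q) = q := by
  let d := hφ.domChart.extend 𝓘(ℝ, E)
  let c := hφ.codChart.extend 𝓘(ℝ, E')
  let pr : E' → E := fun u ↦ (hφ.equiv.symm u).1
  have hw : ∀ q ∈ hφ.domChart.source, c (φ q) = hφ.equiv (d q, 0) := by
    intro q hq
    have h1 : d q ∈ d.target := d.map_source (by simpa [d] using hq)
    have h2 := hφ.writtenInCharts h1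
    have h3 : d.symm (d q) = q := d.left_inv (by simpa [d] using hq)
    simp only [Function.comp_apply] at h2
    rw [← h2]
    exact congrArg (fun r ↦ c (φ r)) h3.symm
  refine ⟨fun m ↦ d.symm (pr (c m)), ?_, ?_⟩
  · have hp := hφ.mem_domChart_source
    have hcp := hφ.mem_codChart_source
    have hpr : ContMDiff 𝓘(ℝ, E') 𝓘(ℝ, E) ∞ pr :=
      (contDiff_fst.comp hφ.equiv.symm.contDiff).contMDiff
    have hc : ContMDiffOn 𝓘(ℝ, E') 𝓘(ℝ, E') ∞ c hφ.codChart.source :=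
      OpenPartialHomeomorph.contMDiffOn_extend hφ.codChart_mem_maximalAtlas
    have hd : ContMDiffOn 𝓘(ℝ, E) 𝓘(ℝ, E) ∞ d.symm hφ.domChart.target := by
      simpa [d] using contMDiffOn_extend_symm hφ.domChart_mem_maximalAtlas
    have hcont : ContinuousAt (fun m ↦ pr (c m)) (φ p) :=
      hpr.continuous.continuousAt.comp
        (hc.continuousOn.continuousAt (hφ.codChart.open_source.mem_nhds hcp))
    have hval : pr (c (φ p)) = d p := by simp [pr, hw p hp]
    have ht : hφ.domChart.target ∈ 𝓝 (pr (c (φ p))) := by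
      rw [hval]
      exact hφ.domChart.open_target.mem_nhds (by simpa [d] using hφ.domChart.map_source hp)
    filter_upwards [hcont.preimage_mem_nhds ht, hφ.codChart.open_source.mem_nhds hcp] with m hm hm'
    exact ((hd _ hm).contMDiffAt (hφ.domChart.open_target.mem_nhds hm)).comp m
      (hpr.contMDiffAt.comp m (hc.contMDiffAt (hφ.codChart.open_source.mem_nhds hm')))
  · filter_upwards [hφ.domChart.open_source.mem_nhds hφ.mem_domChart_source] with q hq
    simp only [hw q hq, pr, ContinuousLinearEquiv.symm_apply_apply]
    exact d.left_inv (by simpa [d] using hq)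

/-- A smooth vector field along an immersion has a local smooth extension. -/
theorem exists_local_extension {p : N}
    (hφ : Manifold.IsImmersionAt 𝓘(ℝ, E) 𝓘(ℝ, E') ∞ φ p)
    {v : Π q : N, TangentSpace 𝓘(ℝ, E') (φ q)}
    (hv : ∀ᶠ q in 𝓝 p, ContMDiffAt 𝓘(ℝ, E) (𝓘(ℝ, E').prod 𝓘(ℝ, E')) ∞
      (fun q ↦ (⟨φ q, v q⟩ : TangentBundle 𝓘(ℝ, E') M)) q) :
    ∃ V : VField E' M, (∀ᶠ m in 𝓝 (φ p), V.SmoothAt m) ∧ ∀ᶠ q in 𝓝 p, V (φ q) = v q := by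
  obtain ⟨ρ, hρ, hρφ⟩ := exists_local_retraction hφ
  set e := trivializationAt E' (TangentSpace 𝓘(ℝ, E') : M → Type _) (φ p) with he
  have hb : e.baseSet ∈ 𝓝 (φ p) :=
    e.open_baseSet.mem_nhds (FiberBundle.mem_baseSet_trivializationAt' _)
  have hφc : ContinuousAt φ p := hφ.continuousAt
  have hρp : ρ (φ p) = p := hρφ.self_of_nhds
  have hρc : Filter.Tendsto ρ (𝓝 (φ p)) (𝓝 p) := by
    have h1 : ContinuousAt ρ (φ p) := hρ.self_of_nhds.continuousAt
    rwa [ContinuousAt, hρp] at h1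
  -- The fibre component of `v` in the trivialization at `φ p`, made constant along the fibres of
  -- the retraction `ρ`.
  let c : M → E' := fun m ↦ (e ⟨φ (ρ m), v (ρ m)⟩).2
  refine ⟨fun m ↦ e.symm m (c m), ?_, ?_⟩
  · filter_upwards [hρ, hρc.eventually hv, hb, hρc.eventually (hφc.eventually hb)]
      with m h1 h2 h3 h4
    have h5 : ContMDiffAt 𝓘(ℝ, E) 𝓘(ℝ, E') ∞ (fun q ↦ (e ⟨φ q, v q⟩).2) (ρ m) :=
      ((e.contMDiffAt_iff (f := fun q ↦ (⟨φ q, v q⟩ : TangentBundle 𝓘(ℝ, E') M))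
        (e.mem_source.2 (show φ (ρ m) ∈ e.baseSet from h4))).1 h2).2
    have h6 : ContMDiffAt 𝓘(ℝ, E') 𝓘(ℝ, E') ∞ c m :=
      ContMDiffAt.comp (g := fun q ↦ (e ⟨φ q, v q⟩).2) m h5 h1
    refine (e.contMDiffAt_iff (e.mem_source.2 h3)).2 ⟨contMDiffAt_id, ?_⟩
    refine h6.congr_of_eventuallyEq ?_
    filter_upwards [e.open_baseSet.mem_nhds h3] with m' hm'
    rw [e.apply_mk_symm hm']
  · filter_upwards [hρφ, hφc.eventually hb] with q hq hq'
    have h1 : c (φ q) = (e ⟨φ q, v q⟩).2 := congrArg (fun r ↦ (e ⟨φ r, v r⟩).2) hq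
    rw [h1]
    exact e.symm_apply_apply_mk hq' (v q)

variable (φ) in
/-- The vector field `X` of `M` is, near `p`, a smooth extension of the push-forward of the smooth
vector field `Xb` of `N`. -/
structure RelatedAt (Xb : VField E N) (X : VField E' M) (p : N) : Prop where
  smooth : ∀ᶠ q in 𝓝 p, Xb.SmoothAt q
  smooth' : ∀ᶠ m in 𝓝 (φ p), X.SmoothAt m
  eq : ∀ᶠ q in 𝓝 p, X (φ q) = push E E' φ q (Xb q)

theorem exists_related {p : N} (hφ : Manifold.IsImmersionAt 𝓘(ℝ, E) 𝓘(ℝ, E') ∞ φ p)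
    (hφs : ContMDiff 𝓘(ℝ, E) 𝓘(ℝ, E') ∞ φ) {Xb : VField E N} (hX : ∀ᶠ q in 𝓝 p, Xb.SmoothAt q) :
    ∃ X : VField E' M, RelatedAt φ Xb X p := by
  obtain ⟨X, h1, h2⟩ := exists_local_extension hφ (v := fun q ↦ push E E' φ q (Xb q))
    (by filter_upwards [hX] with q hq using smoothAt_mfderiv_apply hφs.contMDiffAt hq)
  exact ⟨X, hX, h1, h2⟩

/-- `RelatedAt` asks for smoothness at all points near `p`, which smoothness of order `∞` at `p`
alone does not give. -/
theorem exists_field_smooth_near {p : N} (v : TangentSpace 𝓘(ℝ, E) p) :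
    ∃ V : VField E N, (∀ᶠ q in 𝓝 p, V.SmoothAt q) ∧ V p = v := by
  obtain ⟨s, hs, h⟩ := FiberBundle.exists_contMDiffOn_extend (k := ∞) 𝓘(ℝ, E) E v
  refine ⟨FiberBundle.extend E v, ?_, by simp⟩
  filter_upwards [eventually_mem_nhds_iff.2 hs] with q hq
  exact ContMDiffOn.contMDiffAt h hq

theorem mvfderiv_push {f : M → ℝ} {p : N} (hφs : ContMDiff 𝓘(ℝ, E) 𝓘(ℝ, E') ∞ φ)
    (hf : MDifferentiableAt 𝓘(ℝ, E') 𝓘(ℝ, ℝ) f (φ p)) (v : TangentSpace 𝓘(ℝ, E) p) :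
    mvfderiv 𝓘(ℝ, E') f (φ p) (push E E' φ p v) =
      mvfderiv 𝓘(ℝ, E) (fun q ↦ f (φ q)) p v :=
  (mvfderiv_comp_apply p hf (hφs.mdifferentiable (by simp) p) v).symm

namespace RelatedAt

variable {Xb Yb : VField E N} {X Y : VField E' M} {p : N}

theorem eq_self (h : RelatedAt φ Xb X p) : X (φ p) = push E E' φ p (Xb p) := h.eq.self_of_nhds

/-- Relatedness is an open condition in `p`, so identities between related fields can be
differentiated along `N`. -/
theorem eventually (h : RelatedAt φ Xb X p) (hφs : ContMDiff 𝓘(ℝ, E) 𝓘(ℝ, E') ∞ φ) :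
    ∀ᶠ q in 𝓝 p, RelatedAt φ Xb X q := by
  filter_upwards [h.smooth.eventually_nhds,
    hφs.continuous.continuousAt.eventually h.smooth'.eventually_nhds, h.eq.eventually_nhds]
    with q h1 h2 h3 using ⟨h1, h2, h3⟩

theorem dirDeriv (h : RelatedAt φ Xb X p) (hφs : ContMDiff 𝓘(ℝ, E) 𝓘(ℝ, E') ∞ φ) {f : M → ℝ}
    (hf : MDifferentiableAt 𝓘(ℝ, E') 𝓘(ℝ, ℝ) f (φ p)) :
    dirDeriv X f (φ p) = NullHyp.dirDeriv Xb (fun q ↦ f (φ q)) p := by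
  rw [NullHyp.dirDeriv, h.eq_self, mvfderiv_push hφs hf]
  rfl

/-- Both vectors act on functions as commutators, and `X(f) ∘ φ = Xb(f ∘ φ)` for related fields;
vectors with equal action on functions coincide. -/
theorem lieBr_apply (hX : RelatedAt φ Xb X p) (hY : RelatedAt φ Yb Y p)
    (hφs : ContMDiff 𝓘(ℝ, E) 𝓘(ℝ, E') ∞ φ) :
    lieBr X Y (φ p) = push E E' φ p (lieBr Xb Yb p) := by
  set u := lieBr X Y (φ p)
  set w := push E E' φ p (lieBr Xb Yb p)
  have key : ∀ f : M → ℝ, SmoothFnAt E' f (φ p) →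
      mvfderiv 𝓘(ℝ, E') f (φ p) u = mvfderiv 𝓘(ℝ, E') f (φ p) w := by
    intro f hf
    have hfφ : SmoothFnAt E (fun q ↦ f (φ q)) p := ContMDiffAt.comp p hf hφs.contMDiffAt
    have hXs := hX.smooth'.self_of_nhds
    have hYs := hY.smooth'.self_of_nhds
    have h1 := dirDeriv_lieBr hXs hYs hf
    have h2 := dirDeriv_lieBr hX.smooth.self_of_nhds hY.smooth.self_of_nhds hfφ
    have hev : ∀ᶠ q in 𝓝 p, MDifferentiableAt 𝓘(ℝ, E') 𝓘(ℝ, ℝ) f (φ q) :=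
      hφs.continuous.continuousAt.eventually hf.eventually_diffAt
    have h3 : ∀ {Z W : VField E' M} {Zb Wb : VField E N}, RelatedAt φ Zb Z p →
        RelatedAt φ Wb W p → NullHyp.dirDeriv Z (NullHyp.dirDeriv W f) (φ p) =
          NullHyp.dirDeriv Zb (NullHyp.dirDeriv Wb (fun q ↦ f (φ q))) p := by
      intro Z W Zb Wb hZ hW
      rw [hZ.dirDeriv hφs (SmoothFnAt.dirDeriv hW.smooth'.self_of_nhds hf).diffAt]
      refine dirDeriv_congr ?_
      filter_upwards [hW.eventually hφs, hev] with q hq hq'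
      exact hq.dirDeriv hφs hq'
    rw [mvfderiv_push hφs hf.diffAt]
    change NullHyp.dirDeriv (lieBr X Y) f (φ p) =
      NullHyp.dirDeriv (lieBr Xb Yb) (fun q ↦ f (φ q)) p
    rw [h1, h2, h3 hX hY, h3 hY hX]
  -- Linear functionals composed with a chart separate tangent vectors, since the derivative of the
  -- chart is invertible.
  have hc : ContMDiffAt 𝓘(ℝ, E') 𝓘(ℝ, E') ∞ (extChartAt 𝓘(ℝ, E') (φ p)) (φ p) :=
    contMDiffAt_extChartAt
  have hinj : mfderiv 𝓘(ℝ, E') 𝓘(ℝ, E') (extChartAt 𝓘(ℝ, E') (φ p)) (φ p) u =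
      mfderiv 𝓘(ℝ, E') 𝓘(ℝ, E') (extChartAt 𝓘(ℝ, E') (φ p)) (φ p) w := by
    refine (SeparatingDual.eq_iff_forall_dual_eq (R := ℝ) (V := E')).2 fun L ↦ ?_
    have h1 := key (fun m ↦ L (extChartAt 𝓘(ℝ, E') (φ p) m))
      (L.contMDiff.contMDiffAt.comp (φ p) hc)
    have h2 : ∀ z, mvfderiv 𝓘(ℝ, E') (fun m ↦ L (extChartAt 𝓘(ℝ, E') (φ p) m)) (φ p) z =
        L (mfderiv 𝓘(ℝ, E') 𝓘(ℝ, E') (extChartAt 𝓘(ℝ, E') (φ p)) (φ p) z) := by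
      intro z
      have h3 := mfderiv_comp (φ p) (g := L) (f := extChartAt 𝓘(ℝ, E') (φ p))
        L.mdifferentiableAt
        (hc.mdifferentiableAt (by simp))
      rw [ContinuousLinearMap.mfderiv_eq] at h3
      exact congrArg (fun T : E' →L[ℝ] ℝ ↦ T z) h3
    rwa [h2, h2] at h1
  exact (isInvertible_mfderiv_extChartAt (mem_extChartAt_source (I := 𝓘(ℝ, E')) (φ p))).injective
    hinj

theorem lieBr (hX : RelatedAt φ Xb X p) (hY : RelatedAt φ Yb Y p)
    (hφs : ContMDiff 𝓘(ℝ, E) 𝓘(ℝ, E') ∞ φ) :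
    RelatedAt φ (lieBr Xb Yb) (lieBr X Y) p where
  smooth := by filter_upwards [hX.smooth, hY.smooth] with q h1 h2 using h1.lieBr h2
  smooth' := by filter_upwards [hX.smooth', hY.smooth'] with q h1 h2 using h1.lieBr h2
  eq := by
    filter_upwards [hX.eventually hφs, hY.eventually hφs] with q h1 h2 using h1.lieBr_apply h2 hφs

end RelatedAt

end Related

/-! ### Intrinsic geometry when `U = 0`. -/

section Intrinsic

variable {E : Type*} [NormedAddCommGroup E] [NormedSpace ℝ E] [FiniteDimensional ℝ E]
  {M : Type*} [TopologicalSpace M] [ChartedSpace E M] [IsManifold 𝓘(ℝ, E) ∞ M]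

/-- The extra terms come from `[f X, V] = f [X, V] - V(f) X`. With `X = n` they vanish for `γ`, and
for `Y` they give the products of `dα` and `r`. -/
theorem lieDeriv_smul {T : Tensor2 E M} {f : M → ℝ} {X : VField E M} {x : M} (hT : T.DiffAt x)
    (hf : MDifferentiableAt 𝓘(ℝ, E) 𝓘(ℝ, ℝ) f x) (hX : X.DiffAt x)
    (v w : TangentSpace 𝓘(ℝ, E) x) :
    lieDeriv (f • X) T x v w = f x * lieDeriv X T x v w
      + differential f x v * T x (X x) w + differential f x w * T x v (X x) := by
  obtain ⟨V, hV, rfl⟩ := exists_field v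
  obtain ⟨W, hW, rfl⟩ := exists_field w
  simp only [lieDeriv_apply hT hV hW, lieBr_smul_left hf hX, dirDeriv_smul_left, map_add, map_smul,
    _root_.add_apply, _root_.smul_apply, smul_eq_mul]
  simp only [differential, dirDeriv]
  ring

namespace NullMetricData

variable (D : NullMetricData E M)

theorem smoothAt_n (x : M) : D.n.SmoothAt x := D.n_smooth x

theorem smoothAt_F (x : M) : D.F.SmoothAt x := by
  refine Tensor2.smoothAt_of_apply fun V W hV hW ↦ ?_
  exact contMDiffAt_const.mul ((D.ell_smooth.extDeriv.smoothAt x).apply hV hW)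

theorem smoothAt_s (x : M) : D.s.SmoothAt x :=
  Covector.smoothAt_of_apply fun _ hV ↦ (D.smoothAt_F x).apply (D.smoothAt_n x) hV

/-- `£_a γ = α £_n γ` because `n` is in the radical. If `U(V, W)` were nonzero at `x`, then by
continuity it would be nonzero near `x`, forcing `α = 0` on an open set. -/
theorem U_eq_zero {α : M → ℝ} (hα : ContMDiff 𝓘(ℝ, E) 𝓘(ℝ, ℝ) ∞ α)
    (hint : interior {x | (α • D.n) x = 0} = ∅) (hlie : ∀ x, lieDeriv (α • D.n) D.γ x = 0)
    (x : M) (v w : TangentSpace 𝓘(ℝ, E) x) : D.U x v w = 0 := by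
  obtain ⟨V, hV, rfl⟩ := exists_smooth_field v
  obtain ⟨W, hW, rfl⟩ := exists_smooth_field w
  by_contra hne
  have hf : SmoothFnAt E (fun y ↦ lieDeriv D.n D.γ y (V y) (W y)) x :=
    (Tensor2.SmoothAt.lieDeriv D.γ_smooth (D.smoothAt_n x)).apply hV hW
  have hne' : lieDeriv D.n D.γ x (V x) (W x) ≠ 0 := fun h ↦ hne (by simp [U, h])
  have hev : ∀ᶠ y in 𝓝 x, (α • D.n) y = 0 := by
    filter_upwards [hf.continuousAt.eventually_ne hne'] with y hy
    have h1 := lieDeriv_smul (D.γ_smooth.diffAt y) (hα.mdifferentiable (by simp) y) (D.n_diffAt y)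
      (V y) (W y)
    rw [hlie, (D.n_spec y).1, D.γ_symm y _ (D.n y), (D.n_spec y).1] at h1
    simp only [_root_.zero_apply, mul_zero, add_zero] at h1
    simp [(mul_eq_zero.1 h1.symm).resolve_right hy]
  have : x ∈ interior {x | (α • D.n) x = 0} := mem_interior_iff_mem_nhds.2 hev
  rwa [hint] at this

variable {D}

/-- With `U = 0` the connection `∇°` preserves `γ`. The Koszul formula fixes `∇°_X Z` only up to
multiples of `n`; the `ℓ`-component supplies the rest. -/
theorem apply_cov_nablao (hU : ∀ x v w, D.U x v w = 0)
    {X Z W : VField E M} {x : M} (hX : X.DiffAt x) (hZ : Z.DiffAt x)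
    (hW : W.DiffAt x) :
    D.γ x (cov D.nablao X Z x) (W x) = koszul D.γ Z X W x :=
  apply_cov_eq_koszul D.γ_symm (fun X Z ↦ D.isMetricHypersurfaceConnection.torsion_free X Z x)
    (fun X Z W hX hZ hW ↦ by
      have h := D.isMetricHypersurfaceConnection.nabla_γ X Z W x hX hZ hW
      rw [hU, hU] at h
      rw [h]
      ring) hX hZ hW

theorem ell_cov_nablao (hU : ∀ x v w, D.U x v w = 0)
    {X Z : VField E M} {x : M} (hX : X.DiffAt x) (hZ : Z.DiffAt x) :
    D.ell x (cov D.nablao X Z x) =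
      dirDeriv X (fun y ↦ D.ell y (Z y)) x - D.F x (X x) (Z x) := by
  have h := D.isMetricHypersurfaceConnection.nabla_ell X Z x hX hZ
  rw [hU, mul_zero, sub_zero] at h
  simp only [cov]
  linarith

theorem smoothAt_cov_nablao (hU : ∀ x v w, D.U x v w = 0)
    {X Z : VField E M} {x : M} (hX : X.SmoothAt x) (hZ : Z.SmoothAt x) :
    (cov D.nablao X Z).SmoothAt x := by
  have hl := D.ell_smooth.smoothAt x
  have hγ := D.γ_smooth.smoothAt x
  -- `γ + ℓ ⊗ ℓ` is nondegenerate although `γ` is not: it is positive definite because `ℓ(n) = 1` on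
  -- the radical of `γ`.
  have hB : Tensor2.SmoothAt (fun x ↦ D.γ x + (D.ell x).smulRight (D.ell x)) x :=
    Tensor2.smoothAt_of_apply fun V W hV hW ↦ (hγ.apply hV hW).add ((hl.apply hV).mul (hl.apply hW))
  refine VField.smoothAt_of_tensor2_apply hB ?_ fun W hW ↦ ?_
  · intro y v hv
    have h1 := congrArg (fun f ↦ f v) hv
    simp only [_root_.add_apply, ContinuousLinearMap.smulRight_apply,
      _root_.smul_apply, _root_.zero_apply, smul_eq_mul] at h1
    have h2 := D.psd y v
    exact D.inj (by nlinarith) (by nlinarith)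
  · have h1 := (SmoothFnAt.koszul hγ hZ hX hW).add (((SmoothFnAt.dirDeriv hX (hl.apply hZ)).sub
      ((D.smoothAt_F x).apply hX hZ)).mul (hl.apply hW))
    refine h1.congr_of_eventuallyEq ?_
    filter_upwards [hX.eventually_diffAt, hZ.eventually_diffAt, hW.eventually_diffAt]
      with y hXy hZy hWy
    simp only [_root_.add_apply, ContinuousLinearMap.smulRight_apply, _root_.smul_apply,
      smul_eq_mul, apply_cov_nablao hU hXy hZy hWy, ell_cov_nablao hU hXy hZy]
    rfl

/-- `£_a ℓ = 2 α s + dα` for `a = α n`. -/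
theorem ell_lieBr_smul_n {α : M → ℝ} (hα : ContMDiff 𝓘(ℝ, E) 𝓘(ℝ, ℝ) ∞ α) {W : VField E M} {x : M}
    (hW : W.DiffAt x) :
    D.ell x (lieBr (α • D.n) W x) = dirDeriv (α • D.n) (fun y ↦ D.ell y (W y)) x
      - (2 * (α x * D.s x (W x)) + differential α x (W x)) := by
  have hαx := hα.mdifferentiable (by simp) x
  -- Cartan's formula: `£_a ℓ = dℓ(a, ·) + d(ℓ(a))` with `dℓ = 2 F` and `ℓ(a) = α`.
  have h1 := extDeriv_apply (D.ell_smooth.diffAt x) (VField.DiffAt.smul hαx (D.n_diffAt x)) hW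
  have h2 : (fun y ↦ D.ell y ((α • D.n) y)) = α := by
    ext y
    simp [(D.n_spec y).2]
  rw [h2] at h1
  simp only [s, F, differential, _root_.smul_apply, smul_eq_mul]
  simp only [dirDeriv, Pi.smul_apply', map_smul, _root_.smul_apply, smul_eq_mul] at h1 ⊢
  linarith

/-- The `ℓ`-component of `£_a ∇°` for `a = α n`. -/
theorem ell_lieConnection (hU : ∀ x v w, D.U x v w = 0)
    {α : M → ℝ} (hα : ContMDiff 𝓘(ℝ, E) 𝓘(ℝ, ℝ) ∞ α) {X W : VField E M}
    {x : M} (hX : X.SmoothAt x) (hW : W.SmoothAt x) :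
    D.ell x (lieBr (α • D.n) (cov D.nablao X W) x)
      - D.ell x (cov D.nablao X (lieBr (α • D.n) W) x)
      - D.ell x (cov D.nablao (lieBr (α • D.n) X) W x) =
    covDeriv D.nablao (differential α) x (X x) (W x)
      + 2 * (differential α x (X x) * D.s x (W x))
      + 2 * (α x * covDeriv D.nablao D.s x (X x) (W x))
      - lieDeriv (α • D.n) D.F x (X x) (W x) := by
  set a := α • D.n with ha
  have hαx : SmoothFnAt E α x := hα x
  have has : a.SmoothAt x := VField.SmoothAt.smul hαx (D.smoothAt_n x)
  have hl := D.ell_smooth.smoothAt x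
  have hF := D.smoothAt_F x
  have hs := D.smoothAt_s x
  have hP := smoothAt_cov_nablao hU hX hW
  have hdα : Covector.SmoothAt (differential α : Covector E M) x :=
    Covector.smoothAt_of_apply fun V hV ↦ SmoothFnAt.dirDeriv hV hαx
  have e1 := ell_lieBr_smul_n (D := D) hα hP.diffAt
  rw [← ha] at e1
  have e2 : dirDeriv a (fun y ↦ D.ell y (cov D.nablao X W y)) x =
      dirDeriv a (dirDeriv X (fun y ↦ D.ell y (W y))) x
        - dirDeriv a (fun y ↦ D.F y (X y) (W y)) x := by
    have ev : (fun y ↦ D.ell y (cov D.nablao X W y)) =ᶠ[𝓝 x] fun y ↦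
        dirDeriv X (fun y ↦ D.ell y (W y)) y - D.F y (X y) (W y) := by
      filter_upwards [hX.eventually_diffAt, hW.eventually_diffAt] with y hXy hWy
      exact ell_cov_nablao hU hXy hWy
    rw [dirDeriv_congr ev, dirDeriv_sub (SmoothFnAt.dirDeriv hX (hl.apply hW)).diffAt
      (hF.apply hX hW).diffAt]
  have e3 := ell_cov_nablao hU hX.diffAt (has.lieBr hW).diffAt
  have e4 : dirDeriv X (fun y ↦ D.ell y (lieBr a W y)) x =
      dirDeriv X (dirDeriv a (fun y ↦ D.ell y (W y))) x
        - (2 * (α x * dirDeriv X (fun y ↦ D.s y (W y)) x + D.s x (W x) * dirDeriv X α x)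
          + dirDeriv X (fun y ↦ differential α y (W y)) x) := by
    have ev : (fun y ↦ D.ell y (lieBr a W y)) =ᶠ[𝓝 x] fun y ↦
        dirDeriv a (fun y ↦ D.ell y (W y)) y
          - (2 * (α y * D.s y (W y)) + differential α y (W y)) := by
      filter_upwards [hW.eventually_diffAt] with y hWy
      exact ell_lieBr_smul_n hα hWy
    have d1 : SmoothFnAt E (fun y ↦ α y * D.s y (W y)) x := hαx.mul (hs.apply hW)
    have d2 : SmoothFnAt E (fun y ↦ 2 * (α y * D.s y (W y))) x := contMDiffAt_const.mul d1
    have d3 : SmoothFnAt E (fun y ↦ 2 * (α y * D.s y (W y)) + differential α y (W y)) x :=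
      d2.add (hdα.apply hW)
    rw [dirDeriv_congr ev, dirDeriv_sub (SmoothFnAt.dirDeriv has (hl.apply hW)).diffAt
      d3.diffAt, dirDeriv_add d2.diffAt (hdα.apply hW).diffAt,
      dirDeriv_const_mul d1.diffAt,
      dirDeriv_mul hαx.diffAt (hs.apply hW).diffAt]
  have e5 := ell_cov_nablao hU (has.lieBr hX).diffAt hW.diffAt
  -- Second derivatives of `ℓ(W)` along `a` and `X` cancel against the derivative along `[a, X]`.
  -- The derivatives of `F` assemble into `£_a F`.
  rw [dirDeriv_lieBr has hX (hl.apply hW)] at e5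
  rw [covDeriv_apply hdα.diffAt hX.diffAt hW.diffAt, covDeriv_apply hs.diffAt hX.diffAt hW.diffAt,
    lieDeriv_apply hF.diffAt hX.diffAt hW.diffAt, e1, e2, e3, e4, e5]
  simp only [cov, differential, dirDeriv]
  ring

end NullMetricData

/-! ### The connection `∇° - Y ⊗ n` and the order-one tensor. -/

namespace NullHypersurfaceData

variable (D : NullHypersurfaceData E M)

/-- The vector field `∇°_X W - Y(X, W) n`. -/
noncomputable def tangentialCov (X W : VField E M) : VField E M :=
  cov D.nablao X W - (fun y ↦ D.Y y (X y) (W y)) • D.n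

variable {D}

theorem smoothAt_tangentialCov (hU : ∀ x v w, D.U x v w = 0)
    {X W : VField E M} {x : M} (hX : X.SmoothAt x)
    (hW : W.SmoothAt x) : (D.tangentialCov X W).SmoothAt x :=
  VField.SmoothAt.sub (NullMetricData.smoothAt_cov_nablao hU hX hW)
    (VField.SmoothAt.smul ((D.Y_smooth.smoothAt x).apply hX hW) (D.smoothAt_n x))

/-- Compared with `∇°`, one subtracts `£_a (Y ⊗ n) = (£_a Y) ⊗ n + Y ⊗ [a, n]`. Here `[a, n] = -n(α)
n`, and `£_a Y` is `α £_n Y` plus the symmetrized product of `dα` with `r`. -/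
theorem ell_tangential_lieConnection (hU : ∀ x v w, D.U x v w = 0)
    {α : M → ℝ} (hα : ContMDiff 𝓘(ℝ, E) 𝓘(ℝ, ℝ) ∞ α)
    {X W : VField E M} {x : M} (hX : X.SmoothAt x) (hW : W.SmoothAt x) :
    D.ell x (lieBr (α • D.n) (D.tangentialCov X W) x)
      - D.ell x (D.tangentialCov X (lieBr (α • D.n) W) x)
      - D.ell x (D.tangentialCov (lieBr (α • D.n) X) W x) =
    covDeriv D.nablao (differential α) x (X x) (W x)
      + 2 * (differential α x (X x) * D.s x (W x))
      + 2 * (α x * covDeriv D.nablao D.s x (X x) (W x))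
      - lieDeriv (α • D.n) D.F x (X x) (W x)
      + dirDeriv D.n α x * D.Y x (X x) (W x) - α x * lieDeriv D.n D.Y x (X x) (W x)
      - differential α x (X x) * D.r x (W x) - differential α x (W x) * D.r x (X x) := by
  have hαx : SmoothFnAt E α x := hα x
  have hn := D.smoothAt_n x
  have has : (α • D.n).SmoothAt x := VField.SmoothAt.smul hαx hn
  have hY := D.Y_smooth.smoothAt x
  have hP := NullMetricData.smoothAt_cov_nablao hU hX hW
  have hYn : VField.SmoothAt ((fun y ↦ D.Y y (X y) (W y)) • D.n) x :=
    VField.SmoothAt.smul (hY.apply hX hW) hn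
  have e0 : lieBr (α • D.n) (cov D.nablao X W) x =
      lieBr (α • D.n) (D.tangentialCov X W) x
        + lieBr (α • D.n) ((fun y ↦ D.Y y (X y) (W y)) • D.n) x := by
    rw [← lieBr_add_right (smoothAt_tangentialCov hU hX hW).diffAt hYn.diffAt]
    simp [tangentialCov]
  have e1 := NullMetricData.ell_lieConnection hU hα hX hW
  have hnn : lieBr (α • D.n) D.n x = -dirDeriv D.n α x • D.n x := by
    rw [lieBr_smul_left hαx.diffAt hn.diffAt, lieBr, mlieBracket_self, Pi.zero_apply, smul_zero,
      add_zero]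
  rw [e0, lieBr_smul_right (hY.apply hX hW).diffAt hn.diffAt, hnn] at e1
  have e2 := lieDeriv_smul hY.diffAt hαx.diffAt hn.diffAt (X x) (W x)
  rw [lieDeriv_apply hY.diffAt hX.diffAt hW.diffAt, D.Y_symm x (X x) (D.n x)] at e2
  simp only [map_add, map_smul, smul_eq_mul, (D.n_spec x).2] at e1
  simp only [tangentialCov, Pi.sub_apply, Pi.smul_apply', map_sub, map_smul, smul_eq_mul,
    (D.n_spec x).2, r]
  simp only [tangentialCov] at e1
  linarith

/-- The symmetrized `ℓ`-component of `£_a (∇° - Y ⊗ n)` is the tensor of an abstract Killing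
horizon of order one. -/
theorem ell_tangential_lieConnection_symm (hU : ∀ x v w, D.U x v w = 0)
    {α : M → ℝ} (hα : ContMDiff 𝓘(ℝ, E) 𝓘(ℝ, ℝ) ∞ α)
    {X W : VField E M} {x : M} (hX : X.SmoothAt x) (hW : W.SmoothAt x) :
    (D.ell x (lieBr (α • D.n) (D.tangentialCov X W) x)
      - D.ell x (D.tangentialCov X (lieBr (α • D.n) W) x)
      - D.ell x (D.tangentialCov (lieBr (α • D.n) X) W x))
    + (D.ell x (lieBr (α • D.n) (D.tangentialCov W X) x)
      - D.ell x (D.tangentialCov W (lieBr (α • D.n) X) x)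
      - D.ell x (D.tangentialCov (lieBr (α • D.n) W) X x)) =
    D.orderOneTensor α x (X x) (W x) + D.orderOneTensor α x (W x) (X x) := by
  have hF := (D.smoothAt_F x).diffAt
  -- `£_a F` is antisymmetric like `F`, so it drops out of the symmetrization.
  have hFs : lieDeriv (α • D.n) D.F x (W x) (X x) = - lieDeriv (α • D.n) D.F x (X x) (W x) := by
    rw [lieDeriv_apply hF hX.diffAt hW.diffAt, lieDeriv_apply hF hW.diffAt hX.diffAt]
    have h1 : (fun y ↦ D.F y (W y) (X y)) = fun y ↦ (-1) * D.F y (X y) (W y) := by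
      ext y
      rw [D.F_antisymm y (W y)]
      ring
    rw [h1, dirDeriv_const_mul ((D.smoothAt_F x).apply hX hW).diffAt,
      D.F_antisymm x (lieBr _ W x) (X x), D.F_antisymm x (W x)]
    ring
  rw [ell_tangential_lieConnection hU hα hX hW, ell_tangential_lieConnection hU hα hW hX, hFs]
  simp only [orderOneTensor]
  ring

end NullHypersurfaceData

end Intrinsic

/-! ### Gauss formula and components of `Σ` along the hypersurface. -/

section EmbeddedData

variable {E : Type*} [NormedAddCommGroup E] [NormedSpace ℝ E] [FiniteDimensional ℝ E]
  {N : Type*} [TopologicalSpace N] [ChartedSpace E N] [IsManifold 𝓘(ℝ, E) ∞ N]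
  {E' : Type*} [NormedAddCommGroup E'] [NormedSpace ℝ E'] [FiniteDimensional ℝ E']
  {M : Type*} [TopologicalSpace M] [ChartedSpace E' M] [IsManifold 𝓘(ℝ, E') ∞ M]
  {φ : N → M}

theorem IsExtension.smoothAt {v : Π p : N, TangentSpace 𝓘(ℝ, E') (φ p)} {V : VField E' M}
    (h : IsExtension φ v V) (p : N) : ∀ᶠ m in 𝓝 (φ p), V.SmoothAt m := by
  obtain ⟨O, hO, hr, hs, -⟩ := h
  filter_upwards [hO.mem_nhds (hr ⟨p, rfl⟩)] with m hm using hs.smoothAt hO hm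

theorem IsExtension.apply {v : Π p : N, TangentSpace 𝓘(ℝ, E') (φ p)} {V : VField E' M}
    (h : IsExtension φ v V) (p : N) : V (φ p) = v p := by
  obtain ⟨O, -, -, -, h⟩ := h
  exact h p

theorem IsExtension.relatedAt {Xb : VField E N} {X : VField E' M}
    (h : IsExtension φ (fun p ↦ push E E' φ p (Xb p)) X) (hX : Xb.SmoothOn Set.univ) (p : N) :
    RelatedAt φ Xb X p where
  smooth := Filter.Eventually.of_forall fun q ↦ hX.smoothAt isOpen_univ (Set.mem_univ q)
  smooth' := h.smoothAt p
  eq := Filter.Eventually.of_forall h.apply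

namespace IsEmbedded

variable {D : NullHypersurfaceData E N} {G : LorentzMetric E' M}
  {ζ : Π p : N, TangentSpace 𝓘(ℝ, E') (φ p)}

theorem contMDiff (h : IsEmbedded D G φ ζ) : ContMDiff 𝓘(ℝ, E) 𝓘(ℝ, E') ∞ φ :=
  h.embedding.contMDiff

theorem exists_relatedAt (h : IsEmbedded D G φ ζ) {p : N} (v : TangentSpace 𝓘(ℝ, E) p) :
    ∃ (Vb : VField E N) (V : VField E' M), RelatedAt φ Vb V p ∧ Vb p = v := by
  obtain ⟨Vb, hVb, hv⟩ := exists_field_smooth_near v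
  obtain ⟨V, hV⟩ := exists_related (h.embedding.isImmersion.isImmersionAt p) h.contMDiff hVb
  exact ⟨Vb, V, hV, hv⟩

/-- `(z, c) ↦ φ_⋆ z + c ζ` is injective by transversality and injectivity of `φ_⋆`, and the
dimensions agree. A vector killed by `φ_⋆` has `γ(v, v) = 0` and `ℓ(v) = 0`, hence is zero. -/
theorem exists_decomposition (h : IsEmbedded D G φ ζ) (p : N) (u : TangentSpace 𝓘(ℝ, E') (φ p)) :
    ∃ (z : TangentSpace 𝓘(ℝ, E) p) (c : ℝ), u = push E E' φ p z + c • ζ p := by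
  have hinj : ∀ v, push E E' φ p v = 0 → v = 0 := fun v hv ↦ by
    refine D.inj ?_ ?_
    · rw [← h.pull_γ, hv, map_zero]
    · rw [← h.pull_ell, hv, map_zero]
  let P : E →ₗ[ℝ] E' := (push E E' φ p).toLinearMap
  let L : (E × ℝ) →ₗ[ℝ] E' := P.coprod (LinearMap.toSpanSingleton ℝ E' (ζ p))
  have hLinj : Function.Injective L := by
    refine (injective_iff_map_eq_zero L).2 ?_
    rintro ⟨(z : TangentSpace 𝓘(ℝ, E) p), c⟩ hz
    have hz' : push E E' φ p z + c • ζ p = 0 := hz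
    have hc : c = 0 := by
      by_contra hc
      refine h.transverse p (-(c⁻¹ • z)) ?_
      rw [map_neg, map_smul, eq_neg_of_add_eq_zero_left hz', smul_neg, neg_neg, smul_smul,
        inv_mul_cancel₀ hc, one_smul]
    rw [hc, zero_smul, add_zero] at hz'
    rw [hc, hinj z hz']
    rfl
  have hfin : Module.finrank ℝ (E × ℝ) = Module.finrank ℝ E' := by
    rw [h.dim, Module.finrank_prod, Module.finrank_self]
  obtain ⟨⟨z, c⟩, hzc⟩ :=
    (LinearMap.injective_iff_surjective_of_finrank_eq_finrank hfin).1 hLinj u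
  exact ⟨z, c, hzc.symm⟩

theorem ext_metric (h : IsEmbedded D G φ ζ) {p : N} {u u' : TangentSpace 𝓘(ℝ, E') (φ p)}
    (h1 : ∀ z, G.g (φ p) u (push E E' φ p z) = G.g (φ p) u' (push E E' φ p z))
    (h2 : G.g (φ p) u (ζ p) = G.g (φ p) u' (ζ p)) : u = u' := by
  refine sub_eq_zero.1 (G.inj _ _ ?_)
  ext w
  obtain ⟨z, c, rfl⟩ := h.exists_decomposition p w
  rw [map_sub, _root_.sub_apply, map_add, map_add, map_smul, map_smul, h1, h2, sub_self]
  rfl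

theorem dirDeriv_pull_γ (h : IsEmbedded D G φ ζ) {Xb Zb Wb : VField E N} {X Z W : VField E' M}
    {p : N} (hX : RelatedAt φ Xb X p) (hZ : RelatedAt φ Zb Z p) (hW : RelatedAt φ Wb W p) :
    dirDeriv X (fun m ↦ G.g m (Z m) (W m)) (φ p) =
      dirDeriv Xb (fun q ↦ D.γ q (Zb q) (Wb q)) p := by
  rw [hX.dirDeriv h.contMDiff ((G.smooth.diffAt _).apply hZ.smooth'.self_of_nhds.diffAt
    hW.smooth'.self_of_nhds.diffAt)]
  refine dirDeriv_congr ?_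
  filter_upwards [hZ.eq, hW.eq] with q h1 h2
  rw [h1, h2, h.pull_γ]

theorem koszul_pull (h : IsEmbedded D G φ ζ) {Xb Zb Wb : VField E N} {X Z W : VField E' M}
    {p : N} (hX : RelatedAt φ Xb X p) (hZ : RelatedAt φ Zb Z p) (hW : RelatedAt φ Wb W p) :
    koszul G.g Z X W (φ p) = koszul D.γ Zb Xb Wb p := by
  have hs := h.contMDiff
  rw [koszul, koszul, h.dirDeriv_pull_γ hX hZ hW, h.dirDeriv_pull_γ hZ hW hX,
    h.dirDeriv_pull_γ hW hX hZ, hX.lieBr_apply hZ hs, hZ.lieBr_apply hW hs, hW.lieBr_apply hX hs,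
    hX.eq_self, hZ.eq_self, hW.eq_self, h.pull_γ, h.pull_γ, h.pull_γ]

theorem dirDeriv_pull_ell (h : IsEmbedded D G φ ζ) {ζx : VField E' M} (hζ : IsExtension φ ζ ζx)
    {Xb Wb : VField E N} {X W : VField E' M} {p : N} (hX : RelatedAt φ Xb X p)
    (hW : RelatedAt φ Wb W p) :
    dirDeriv X (fun m ↦ G.g m (ζx m) (W m)) (φ p) = dirDeriv Xb (fun q ↦ D.ell q (Wb q)) p := by
  rw [hX.dirDeriv h.contMDiff ((G.smooth.diffAt _).apply (hζ.smoothAt p).self_of_nhds.diffAt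
    hW.smooth'.self_of_nhds.diffAt)]
  refine dirDeriv_congr ?_
  filter_upwards [hW.eq] with q h1
  rw [h1, hζ.apply, h.pull_ell]

/-- The Gauss formula `∇_X W = ∇°_X W - Y(X, W) n` for vector fields tangent to a totally geodesic
null hypersurface. -/
theorem cov_eq_push (h : IsEmbedded D G φ ζ) (hU : ∀ x v w, D.U x v w = 0) {Xb Wb : VField E N}
    {X W : VField E' M} {p : N} (hX : RelatedAt φ Xb X p) (hW : RelatedAt φ Wb W p) :
    cov G.leviCivita X W (φ p) = push E E' φ p (D.tangentialCov Xb Wb p) := by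
  have hXd := hX.smooth'.self_of_nhds.diffAt
  have hWd := hW.smooth'.self_of_nhds.diffAt
  have hXb := hX.smooth.self_of_nhds.diffAt
  have hWb := hW.smooth.self_of_nhds.diffAt
  refine h.ext_metric (fun z ↦ ?_) ?_
  -- Tangential components: both sides obey the Koszul formula of `γ`, and `γ` does not see the term
  -- along `n`.
  · obtain ⟨Zb, Z, hZ, rfl⟩ := h.exists_relatedAt z
    rw [h.pull_γ, ← hZ.eq_self, G.apply_cov hXd hWd hZ.smooth'.self_of_nhds.diffAt,
      h.koszul_pull hX hW hZ,
      ← NullMetricData.apply_cov_nablao hU hXb hWb hZ.smooth.self_of_nhds.diffAt]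
    simp [NullHypersurfaceData.tangentialCov, (D.n_spec p).1]
  -- Rigging component: `g(∇_X ζ, W)` has symmetric part `½ £_ζ g = Y` and antisymmetric part `½ dℓ
  -- = F`. Hence `g(ζ, ∇_X W) = X(ℓ(W)) - F(X, W) - Y(X, W)`, and the first two terms make up
  -- `ℓ(∇°_X W)`.
  · obtain ⟨ζx, hζ, hY⟩ := h.pull_Y
    have hζd := (hζ.smoothAt p).self_of_nhds.diffAt
    have h1 := G.dirDeriv_metric hXd hζd hWd
    have h1' := G.dirDeriv_metric hWd hζd hXd
    have h2 := lieDeriv_apply (X := ζx) (G.smooth.diffAt (φ p)) hXd hWd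
    rw [G.dirDeriv_metric hζd hXd hWd, ← G.cov_sub_cov hζd hXd, ← G.cov_sub_cov hζd hWd] at h2
    have h3 := hY p (Xb p) (Wb p)
    rw [← hX.eq_self, ← hW.eq_self] at h3
    have h4 := extDeriv_apply (D.ell_smooth.diffAt p) hXb hWb
    rw [h.dirDeriv_pull_ell hζ hX hW] at h1
    rw [h.dirDeriv_pull_ell hζ hW hX] at h1'
    have h5 : D.ell p (lieBr Xb Wb p) = G.g (φ p) (ζx (φ p)) (lieBr X W (φ p)) := by
      rw [hX.lieBr_apply hW h.contMDiff, hζ.apply, h.pull_ell]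
    rw [h5, h1, h1', ← G.cov_sub_cov hXd hWd] at h4
    have h6 := NullMetricData.ell_cov_nablao hU hXb hWb
    have h7 : D.F p (Xb p) (Wb p) = (1 / 2) * extDeriv D.ell p (Xb p) (Wb p) := rfl
    rw [h7, h4] at h6
    have h8 : G.g (φ p) (push E E' φ p (D.tangentialCov Xb Wb p)) (ζ p) =
        D.ell p (cov D.nablao Xb Wb p) - D.Y p (Xb p) (Wb p) := by
      rw [G.symm, h.pull_ell]
      simp [NullHypersurfaceData.tangentialCov, (D.n_spec p).2]
    rw [h8, h6, ← h3, h2, h1, ← hζ.apply, G.symm (φ p) _ (ζx (φ p))]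
    simp only [map_sub, _root_.sub_apply, G.symm (φ p) (X (φ p))]
    ring

theorem relatedAt_cov (h : IsEmbedded D G φ ζ) (hU : ∀ x v w, D.U x v w = 0) {Xb Wb : VField E N}
    {X W : VField E' M} {p : N} (hX : RelatedAt φ Xb X p) (hW : RelatedAt φ Wb W p) :
    RelatedAt φ (D.tangentialCov Xb Wb) (cov G.leviCivita X W) p where
  smooth := by
    filter_upwards [hX.smooth, hW.smooth] with q h1 h2
    exact NullHypersurfaceData.smoothAt_tangentialCov hU h1 h2
  smooth' := by
    filter_upwards [hX.smooth', hW.smooth'] with m h1 h2 using G.smoothAt_cov h1 h2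
  eq := by
    filter_upwards [hX.eventually h.contMDiff, hW.eventually h.contMDiff] with q h1 h2
    exact h.cov_eq_push hU h1 h2

theorem deformation_pull (h : IsEmbedded D G φ ζ) {ηb : VField E N} {η : VField E' M} {p : N}
    (hη : RelatedAt φ ηb η p) (v w : TangentSpace 𝓘(ℝ, E) p) :
    deformation G η (φ p) (push E E' φ p v) (push E E' φ p w) = lieDeriv ηb D.γ p v w := by
  obtain ⟨Vb, V, hV, rfl⟩ := h.exists_relatedAt v
  obtain ⟨Wb, W, hW, rfl⟩ := h.exists_relatedAt w
  rw [← hV.eq_self, ← hW.eq_self, G.deformation_apply hV.smooth'.self_of_nhds.diffAt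
    hW.smooth'.self_of_nhds.diffAt, lieDeriv_apply (D.γ_smooth.diffAt p)
    hV.smooth.self_of_nhds.diffAt hW.smooth.self_of_nhds.diffAt, h.dirDeriv_pull_γ hη hV hW,
    hη.lieBr_apply hV h.contMDiff, hη.lieBr_apply hW h.contMDiff, hV.eq_self, hW.eq_self,
    h.pull_γ, h.pull_γ]

/-- `K` vanishes on tangent vectors all along the hypersurface, and covariant derivatives of tangent
fields stay tangent. -/
theorem covDeriv2_deformation_tangent (h : IsEmbedded D G φ ζ) (hU : ∀ x v w, D.U x v w = 0)
    {η : VField E' M}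
    (hK : ∀ q v w, deformation G η (φ q) (push E E' φ q v) (push E E' φ q w) = 0)
    {Xb Wb Zb : VField E N} {X W Z : VField E' M} {p : N} (hη : η.SmoothAt (φ p))
    (hX : RelatedAt φ Xb X p) (hW : RelatedAt φ Wb W p) (hZ : RelatedAt φ Zb Z p) :
    covDeriv2 G.leviCivita (deformation G η) X W Z (φ p) = 0 := by
  have hd := ((G.smoothAt_deformation hη).apply hW.smooth'.self_of_nhds
    hZ.smooth'.self_of_nhds).diffAt
  have h0 : dirDeriv X (fun m ↦ deformation G η m (W m) (Z m)) (φ p) = 0 := by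
    rw [hX.dirDeriv h.contMDiff hd, ← dirDeriv_const Xb 0 p]
    refine dirDeriv_congr ?_
    filter_upwards [hW.eq, hZ.eq] with q h1 h2
    rw [h1, h2, hK]
  rw [covDeriv2, h0, h.cov_eq_push hU hX hW, h.cov_eq_push hU hX hZ, hW.eq_self, hZ.eq_self, hK, hK]
  ring

theorem lieConnection_tangent (h : IsEmbedded D G φ ζ) (hU : ∀ x v w, D.U x v w = 0)
    {η : VField E' M}
    (hK : ∀ q v w, deformation G η (φ q) (push E E' φ q v) (push E E' φ q w) = 0)
    {Xb Wb : VField E N} {X W : VField E' M} {p : N} (hη : η.SmoothAt (φ p))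
    (hX : RelatedAt φ Xb X p) (hW : RelatedAt φ Wb W p) (z : TangentSpace 𝓘(ℝ, E) p) :
    G.g (φ p) (lieConnection G.leviCivita η X W (φ p)) (push E E' φ p z) = 0 := by
  obtain ⟨Zb, Z, hZ, rfl⟩ := h.exists_relatedAt z
  have h1 := G.two_mul_lieConnection hη hX.smooth'.self_of_nhds hW.smooth'.self_of_nhds
    hZ.smooth'.self_of_nhds
  rw [h.covDeriv2_deformation_tangent hU hK hη hX hW hZ,
    h.covDeriv2_deformation_tangent hU hK hη hW hX hZ,
    h.covDeriv2_deformation_tangent hU hK hη hZ hX hW] at h1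
  rw [← hZ.eq_self]
  linarith

theorem smoothAt_qForm (h : IsEmbedded D G φ ζ) {η : VField E' M} {p : N}
    (hη : η.SmoothAt (φ p)) : (qForm G η φ ζ : Covector E N).SmoothAt p := by
  refine Covector.smoothAt_of_apply fun V hV ↦ ?_
  have hK : ContMDiffAt 𝓘(ℝ, E) (𝓘(ℝ, E').prod 𝓘(ℝ, E' →L[ℝ] E' →L[ℝ] ℝ)) ∞
      (fun q ↦ TotalSpace.mk' (E' →L[ℝ] E' →L[ℝ] ℝ)
        (E := fun x : M ↦ TangentSpace 𝓘(ℝ, E') x →L[ℝ] TangentSpace 𝓘(ℝ, E') x →L[ℝ] ℝ)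
        (φ q) (deformation G η (φ q))) p :=
    ContMDiffAt.comp p (G.smoothAt_deformation hη) h.contMDiff.contMDiffAt
  have := ContMDiffAt.clm_bundle_apply₂ (F₃ := ℝ) (E₃ := Bundle.Trivial M ℝ) (b := φ)
    (ψ := fun q ↦ deformation G η (φ q)) (v := ζ) (w := fun q ↦ push E E' φ q (V q)) hK
    (h.rigging_smooth p) (smoothAt_mfderiv_apply h.contMDiff.contMDiffAt hV)
  rw [contMDiffAt_totalSpace] at this
  exact this.2

/-- The Gauss formula splits `K(ζ, ∇_X W)` into `𝔮(∇°_X W) - 𝔴 Y(X, W)`. The term with `∇_X ζ` is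
kept: it is absorbed by `£_ζ K` later. -/
theorem covDeriv2_deformation_rigging (h : IsEmbedded D G φ ζ) (hU : ∀ x v w, D.U x v w = 0)
    {η ζx : VField E' M} (hζ : IsExtension φ ζ ζx) {Xb Wb : VField E N} {X W : VField E' M} {p : N}
    (hη : η.SmoothAt (φ p)) (hX : RelatedAt φ Xb X p) (hW : RelatedAt φ Wb W p) :
    covDeriv2 G.leviCivita (deformation G η) X W ζx (φ p) =
      covDeriv D.nablao (qForm G η φ ζ) p (Xb p) (Wb p)
      + wFun D G η φ ζ p * D.Y p (Xb p) (Wb p)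
      - deformation G η (φ p) (W (φ p)) (cov G.leviCivita X ζx (φ p)) := by
  have hd := ((G.smoothAt_deformation hη).apply hW.smooth'.self_of_nhds
    (hζ.smoothAt p).self_of_nhds).diffAt
  have h0 : dirDeriv X (fun m ↦ deformation G η m (W m) (ζx m)) (φ p) =
      dirDeriv Xb (fun q ↦ qForm G η φ ζ q (Wb q)) p := by
    rw [hX.dirDeriv h.contMDiff hd]
    refine dirDeriv_congr ?_
    filter_upwards [hW.eq] with q h1
    rw [h1, hζ.apply, G.deformation_symm]
    rfl
  rw [covDeriv2, h0, h.cov_eq_push hU hX hW, covDeriv_apply (h.smoothAt_qForm hη).diffAt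
    hX.smooth.self_of_nhds.diffAt hW.smooth.self_of_nhds.diffAt, hζ.apply, G.deformation_symm]
  simp only [NullHypersurfaceData.tangentialCov, Pi.sub_apply, Pi.smul_apply', map_sub, map_smul,
    smul_eq_mul, qForm, wFun, ContinuousLinearMap.comp_apply, cov]
  ring

/-- `g((£_η ∇)(X, W), ζ) = 𝔅(X, W)`. -/
theorem lieConnection_rigging (h : IsEmbedded D G φ ζ) (hU : ∀ x v w, D.U x v w = 0)
    {η ζx : VField E' M} (hζ : IsExtension φ ζ ζx) {Xb Wb : VField E N} {X W : VField E' M} {p : N}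
    (hη : η.SmoothAt (φ p)) (hX : RelatedAt φ Xb X p) (hW : RelatedAt φ Wb W p) :
    G.g (φ p) (lieConnection G.leviCivita η X W (φ p)) (ζ p) =
      BTensor D G η φ ζ ζx p (Xb p) (Wb p) := by
  have hζs := (hζ.smoothAt p).self_of_nhds
  have hXs := hX.smooth'.self_of_nhds
  have hWs := hW.smooth'.self_of_nhds
  have h1 := G.two_mul_lieConnection hη hXs hWs hζs
  -- `(£_ζ K)(X, W) = (∇_ζ K)(X, W) + K(∇_X ζ, W) + K(X, ∇_W ζ)`: this collects `∇_ζ K` and the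
  -- leftover `∇ζ` terms into `2 ℑ`. The term `𝔭 U` of `𝔅` is zero.
  have h2 := lieDeriv_apply (X := ζx) (G.smoothAt_deformation hη).diffAt hXs.diffAt hWs.diffAt
  rw [← G.cov_sub_cov hζs.diffAt hXs.diffAt, ← G.cov_sub_cov hζs.diffAt hWs.diffAt] at h2
  rw [h.covDeriv2_deformation_rigging hU hζ hη hX hW,
    h.covDeriv2_deformation_rigging hU hζ hη hW hX, covDeriv2] at h1
  simp only [map_sub, _root_.sub_apply] at h2
  rw [G.deformation_symm η (φ p) (W (φ p))] at h1
  rw [D.Y_symm p (Wb p)] at h1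
  rw [← hζ.apply, BTensor, ITensor, hU, ← hX.eq_self, ← hW.eq_self]
  linarith

/-- Every field in the definition of `Σ(X, W)` is a push-forward, so `Σ(X, W)` is one too. Pairing
with `ζ` takes the `ℓ`-component on `N`. -/
theorem lieConnection_rigging_symm (h : IsEmbedded D G φ ζ) (hU : ∀ x v w, D.U x v w = 0)
    {α : N → ℝ} (hα : ContMDiff 𝓘(ℝ, E) 𝓘(ℝ, ℝ) ∞ α) {η : VField E' M} {Xb Wb : VField E N}
    {X W : VField E' M} {p : N} (hη : RelatedAt φ (α • D.n) η p) (hX : RelatedAt φ Xb X p)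
    (hW : RelatedAt φ Wb W p) :
    G.g (φ p) (lieConnection G.leviCivita η X W (φ p)) (ζ p)
      + G.g (φ p) (lieConnection G.leviCivita η W X (φ p)) (ζ p) =
    D.orderOneTensor α p (Xb p) (Wb p) + D.orderOneTensor α p (Wb p) (Xb p) := by
  have hs := h.contMDiff
  have key : ∀ {Xb Wb : VField E N} {X W : VField E' M}, RelatedAt φ Xb X p →
      RelatedAt φ Wb W p → G.g (φ p) (lieConnection G.leviCivita η X W (φ p)) (ζ p) =
        D.ell p (lieBr (α • D.n) (D.tangentialCov Xb Wb) p)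
          - D.ell p (D.tangentialCov Xb (lieBr (α • D.n) Wb) p)
          - D.ell p (D.tangentialCov (lieBr (α • D.n) Xb) Wb p) := by
    intro Xb Wb X W hX hW
    rw [LorentzMetric.lieConnection_eq, hη.lieBr_apply (h.relatedAt_cov hU hX hW) hs,
      h.cov_eq_push hU hX (hη.lieBr hW hs), h.cov_eq_push hU (hη.lieBr hX hs) hW, G.symm,
      ← map_sub, ← map_sub, h.pull_ell, map_sub, map_sub]
  rw [key hX hW, key hW hX]
  exact NullHypersurfaceData.ell_tangential_lieConnection_symm hU hα hX.smooth.self_of_nhds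
    hW.smooth.self_of_nhds

end IsEmbedded

end EmbeddedData

end NullHyp

/-! ### The proposition. -/

theorem proposition6p5
    {E : Type*} [NormedAddCommGroup E] [NormedSpace ℝ E] [FiniteDimensional ℝ E]
    {N : Type*} [TopologicalSpace N] [T2Space N] [SecondCountableTopology N] [ConnectedSpace N]
    [ChartedSpace E N] [IsManifold 𝓘(ℝ, E) ∞ N]
    {E' : Type*} [NormedAddCommGroup E'] [NormedSpace ℝ E'] [FiniteDimensional ℝ E']
    {M : Type*} [TopologicalSpace M] [T2Space M] [SecondCountableTopology M] [ConnectedSpace M]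
    [ChartedSpace E' M] [IsManifold 𝓘(ℝ, E') ∞ M]
    (D : NullHyp.NullHypersurfaceData E N) (ηbar : NullHyp.VField E N) (hD : D.IsAKH1 ηbar)
    (G : NullHyp.LorentzMetric E' M) (φ : N → M) (ζ : Π p : N, TangentSpace 𝓘(ℝ, E') (φ p))
    (hemb : NullHyp.IsEmbedded D G φ ζ)
    (η : NullHyp.VField E' M)
    (hη : NullHyp.IsExtension φ (fun p ↦ NullHyp.push E E' φ p (ηbar p)) η) :
    (∀ (p : N) (Z₁ Z₂ : TangentSpace 𝓘(ℝ, E) p) (X₁ X₂ : NullHyp.VField E' M) (O : Set M),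
      IsOpen O → φ p ∈ O → X₁.SmoothOn O → X₂.SmoothOn O →
      X₁ (φ p) = NullHyp.push E E' φ p Z₁ → X₂ (φ p) = NullHyp.push E E' φ p Z₂ →
      NullHyp.lieConnection G.leviCivita η X₁ X₂ (φ p) = 0) ∧
    ∀ ζx : NullHyp.VField E' M, NullHyp.IsExtension φ ζ ζx →
      (∀ (p : N) (v w : TangentSpace 𝓘(ℝ, E) p), NullHyp.BTensor D G η φ ζ ζx p v w = 0) ∧
      ((∀ p : N, (NullHyp.qForm G η φ ζ p : TangentSpace 𝓘(ℝ, E) p →L[ℝ] ℝ) = 0) →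
        ∀ (p : N) (v w : TangentSpace 𝓘(ℝ, E) p),
          NullHyp.lieDeriv ζx (NullHyp.deformation G η) (φ p)
            (NullHyp.push E E' φ p v) (NullHyp.push E E' φ p w) = 0) := by
  obtain ⟨α, hα, hηα, hone⟩ := hD.order_one
  obtain rfl : ηbar = α • D.n := funext hηα
  have hU : ∀ x v w, D.U x v w = 0 := D.U_eq_zero hα hD.interior_zeros hD.lie_γ
  have hrel := hη.relatedAt hD.smooth
  have hηs : ∀ p, η.SmoothAt (φ p) := fun p ↦ (hrel p).smooth'.self_of_nhds
  have hK : ∀ q v w, NullHyp.deformation G η (φ q) (NullHyp.push E E' φ q v)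
      (NullHyp.push E E' φ q w) = 0 := fun q v w ↦ by
    rw [hemb.deformation_pull (hrel q), hD.lie_γ]
    rfl
  have hB : ∀ {p : N} {Xb Wb : NullHyp.VField E N} {X W : NullHyp.VField E' M},
      NullHyp.RelatedAt φ Xb X p → NullHyp.RelatedAt φ Wb W p →
      G.g (φ p) (NullHyp.lieConnection G.leviCivita η X W (φ p)) (ζ p) = 0 := by
    intro p Xb Wb X W hX hW
    have h1 := hemb.lieConnection_rigging_symm hU hα (hrel p) hX hW
    -- By symmetry of `Σ` the left side is twice the wanted component; the right side vanishes by
    -- the order-one condition.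
    rw [G.lieConnection_symm (hηs p) hW.smooth'.self_of_nhds hX.smooth'.self_of_nhds, hone,
      hone] at h1
    linarith
  have hBζ : ∀ ζx : NullHyp.VField E' M, NullHyp.IsExtension φ ζ ζx →
      ∀ (p : N) (v w : TangentSpace 𝓘(ℝ, E) p), NullHyp.BTensor D G η φ ζ ζx p v w = 0 := by
    intro ζx hζ p v w
    obtain ⟨Vb, V, hV, rfl⟩ := hemb.exists_relatedAt v
    obtain ⟨Wb, W, hW, rfl⟩ := hemb.exists_relatedAt w
    rw [← hemb.lieConnection_rigging hU hζ (hηs p) hV hW, hB hV hW]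
  refine ⟨?_, fun ζx hζ ↦ ⟨hBζ ζx hζ, ?_⟩⟩
  · intro p Z₁ Z₂ X₁ X₂ O hO hp hX₁ hX₂ h₁ h₂
    obtain ⟨V₁b, V₁, hV₁, rfl⟩ := hemb.exists_relatedAt Z₁
    obtain ⟨V₂b, V₂, hV₂, rfl⟩ := hemb.exists_relatedAt Z₂
    -- `X₁`, `X₂` are tangent only at `φ p`, so they are traded for fields tangent along the
    -- hypersurface with the same values there.
    have hcongr : ∀ u : TangentSpace 𝓘(ℝ, E') (φ p),
        G.g (φ p) (NullHyp.lieConnection G.leviCivita η X₁ X₂ (φ p)) u =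
          G.g (φ p) (NullHyp.lieConnection G.leviCivita η V₁ V₂ (φ p)) u := by
      intro u
      obtain ⟨Z, hZ, rfl⟩ := NullHyp.exists_smooth_field u
      exact G.lieConnection_congr (hηs p) (hX₁.smoothAt hO hp) (hX₂.smoothAt hO hp) hZ
        hV₁.smooth'.self_of_nhds hV₂.smooth'.self_of_nhds hZ (h₁.trans hV₁.eq_self.symm)
        (h₂.trans hV₂.eq_self.symm) rfl
    refine hemb.ext_metric (fun z ↦ ?_) ?_
    · rw [hcongr, hemb.lieConnection_tangent hU hK (hηs p) hV₁ hV₂ z, map_zero]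
      rfl
    · rw [hcongr, hB hV₁ hV₂, map_zero]
      rfl
  · intro hq p v w
    have hq0 : NullHyp.qForm G η φ ζ = 0 := funext hq
    -- Differentiability of `𝔮` is what makes `∇°𝔮` given by its formula, which is then visibly
    -- zero.
    have hcov : ∀ v w, NullHyp.covDeriv D.nablao (NullHyp.qForm G η φ ζ) p v w = 0 := by
      intro v w
      obtain ⟨V, hV, rfl⟩ := NullHyp.exists_field v
      obtain ⟨W, hW, rfl⟩ := NullHyp.exists_field w
      rw [NullHyp.covDeriv_apply (hemb.smoothAt_qForm (hηs p)).diffAt hV hW, hq0]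
      exact (sub_zero _).trans (NullHyp.dirDeriv_const V 0 p)
    have hw : NullHyp.wFun D G η φ ζ p = 0 := congrArg (fun f ↦ f (D.n p)) (hq p)
    have h1 := hBζ ζx hζ p v w
    rw [NullHyp.BTensor, hcov, hcov, hw, hU, NullHyp.ITensor] at h1
    linarith
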